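/- Let $R$ be a commutative ring and let $I' \subseteq I$ and $J' \subseteq J$ be ideals of $R$ such that each of the pairs $\{I,J\}$, $\{I',J\}$, $\{I,J'\}$ is Tor-independent, where $\{A,B\}$ is called Tor-independent if $\operatorname{Tor}_i^R(R/A,R/B)=0$ for all $i\ge 1$. By a free resolution of a cyclic module $R/A$ we mean a complex $C$ of free $R$-modules, $C_n=0$ for $n<0$, with $C_0=R$ (up to a fixed isomorphism) such that $\cdots\to C_2\to C_1\to C_0=R\to R/A\to 0$ is exact, where $R\to R/A$ is the quotient map. Let $X,Y,S,T$ be free resolutions of $R/I$, $R/J$, $R/I'$, $R/J'$, respectively, and let $\phi:S\to X$ and $\psi:T\to Y$ be chain maps with $\phi_0=1_R$ and $\psi_0=1_R$ (so they lift the natural surjections $R/I'\to R/I$ and $R/J'\to R/J$). For a complex $C$ let $C_{\ge 1}$ be its hard truncation (equal to $C$ in degrees $\geq 1$ and to $0$ in degrees $\leq 0$), and let $\Sigma^{-1}C$ be the complex with $(\Sigma^{-1}C)_n=C_{n+1}$ and differential $-\partial^C$. Tensor products of complexes have differential $\partial(a\otimes b)=\partial a\otimes b+(-1)^{|a|}a\otimes\partial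 b$. The star product $X*Y$ is the complex with $$(X*Y)_0=X_0\otimes_R Y_0,\qquad (X*Y)_n=(X_{\ge1}\otimes_R Y_{\ge1})_{n+1}\quad(n\ge1),$$ whose differential is $\partial_{n+1}^{X_{\ge1}\otimes Y_{\ge1}}$ in degree $n\ge2$ and $\partial_1^X\otimes\partial_1^Y$ in degree $1$; for $|a|,|b|\geq 1$ the element $a\otimes b$, regarded in degree $|a|+|b|-1$ of $X*Y$, is denoted $a*b$, and elements $a\otimes b$ of $X_0\otimes_R Y_0$ are also written $a*b$. The following formulas define chain maps $$\Phi:\Sigma^{-1}(S_{\ge1}\otimes_R Y)\to X*Y,\qquad \Phi(\alpha\otimes\beta)=\begin{cases}(-1)^{|\alpha|+|\beta|}\,\phi(\alpha)*\beta & |\beta|>0,\\ \partial_1^S(\alpha)*\beta & |\beta|=0,\ |\alpha|=1,\\ 0&|\beta|=0,\ |\alpha|>1,\end{cases}$$ $$\Psi:\Sigma^{-1}(X\otimes_R T_{\ge1})\to X*Y,\qquad \Psi(\alpha\otimes\beta)=\begin{cases}(-1)^{|\alpha|+|\beta|-1}\,\alpha*\psi(\beta) & |\alpha|>0,\\ \alpha*\partial_1^T(\beta)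 & |\alpha|=0,\ |\beta|=1,\\ 0&|\alpha|=0,\ |\beta|>1,\end{cases}$$ where $S_0=R=X_0$ and $T_0=R=Y_0$ are identified. For a chain map $f:A\to B$, let $\operatorname{Cone}(f)$ be its mapping cone, $\operatorname{Cone}(f)_n=B_n\oplus A_{n-1}$ with differential $(b,a)\mapsto(\partial b+f(a),-\partial a)$. Then $\operatorname{Cone}(\Phi)$ is a free resolution of $R/(I'+IJ)$ over $R$, and $\operatorname{Cone}(\Psi)$ is a free resolution of $R/(IJ+J')$ over $R$. -/

import Mathlib

open CategoryTheory MonoidalCategory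

universe u

namespace StarCone

noncomputable section

variable {R : Type u} [CommRing R]

/-- The ideals `I` and `J` are Tor-independent: `Tor_i^R (R / I, R / J) = 0` for all `i ≥ 1`. -/
def TorIndependent (I J : Ideal R) : Prop :=
  ∀ i : ℕ, 1 ≤ i → Limits.IsZero
    (((Tor (ModuleCat.{u} R) i).obj (ModuleCat.of R (R ⧸ I))).obj (ModuleCat.of R (R ⧸ J)))

/-- The complex `C`, with augmentation `ε : C₀ → M`, is a free resolution of `M` over `R`:
every `Cₙ` is free and `⋯ → C₂ → C₁ → C₀ → M → 0` is exact. -/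
structure IsFreeResolution (C : ChainComplex (ModuleCat.{u} R) ℕ)
    {M : Type u} [AddCommGroup M] [Module R M] (ε : C.X 0 →ₗ[R] M) : Prop where
  free : ∀ n, Module.Free R (C.X n)
  exact_succ : ∀ n, Function.Exact (C.d (n + 2) (n + 1)).hom (C.d (n + 1) n).hom
  exact_zero : Function.Exact (C.d 1 0).hom ε
  surjective : Function.Surjective ε

/-- The hard truncation `C_{≥ 1}`: zero in degree `0`, equal to `C` in positive degrees. -/
def trunc (C : ChainComplex (ModuleCat.{u} R) ℕ) : ChainComplex (ModuleCat.{u} R) ℕ :=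
  (ChainComplex.truncate.obj C).augment
    (0 : (ChainComplex.truncate.obj C).X 0 ⟶ ModuleCat.of R PUnit) Limits.comp_zero

/-- The desuspension `Σ⁻¹ C`, with `(Σ⁻¹ C)ₙ = Cₙ₊₁` and differential `-∂`. It is only used for
complexes `C` that vanish in degree `0` (so that nothing is lost in degree `-1`). -/
def desusp (C : ChainComplex (ModuleCat.{u} R) ℕ) : ChainComplex (ModuleCat.{u} R) ℕ where
  X n := C.X (n + 1)
  d i j := -C.d (i + 1) (j + 1)
  shape i j h := by
    rw [C.shape _ _ (by simpa using h), neg_zero]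
  d_comp_d' i j k _ _ := by simp

/-! ### The differential of a tensor product on its summands

`HomologicalComplex.tensorObj K L` is the total tensor product, with
`∂ (a ⊗ b) = ∂ a ⊗ b + (-1) ^ |a| a ⊗ ∂ b`. -/

section tensor

open HomologicalComplex hiding tensorObj

variable (K L : ChainComplex (ModuleCat.{u} R) ℕ)

lemma tensor_d_succ_succ (i j n : ℕ) (h : i + 1 + (j + 1) = n + 1) :
    ιTensorObj K L (i + 1) (j + 1) (n + 1) h ≫ (HomologicalComplex.tensorObj K L).d (n + 1) n =
      (K.d (i + 1) i ▷ L.X (j + 1)) ≫ ιTensorObj K L i (j + 1) n (by omega) +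
        (-1 : ℤ) ^ (i + 1) • ((K.X (i + 1) ◁ L.d (j + 1) j) ≫
          ιTensorObj K L (i + 1) j n (by omega)) := by
  rw [mapBifunctor.d_eq, Preadditive.comp_add, mapBifunctor.ι_D₁, mapBifunctor.ι_D₂,
    mapBifunctor.d₁_eq K L _ _ (i₁ := i + 1) (i₁' := i) rfl (j + 1) n (by simp; omega),
    mapBifunctor.d₂_eq K L _ _ (i + 1) (i₂ := j + 1) (i₂' := j) rfl n (by simp; omega)]
  congr 1
  simp

lemma tensor_d_succ_zero (i n : ℕ) (h : i + 1 + 0 = n + 1) :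
    ιTensorObj K L (i + 1) 0 (n + 1) h ≫ (HomologicalComplex.tensorObj K L).d (n + 1) n =
      (K.d (i + 1) i ▷ L.X 0) ≫ ιTensorObj K L i 0 n (by omega) := by
  rw [mapBifunctor.d_eq, Preadditive.comp_add, mapBifunctor.ι_D₁, mapBifunctor.ι_D₂,
    mapBifunctor.d₁_eq K L _ _ (i₁ := i + 1) (i₁' := i) rfl 0 n (by simp; omega),
    mapBifunctor.d₂_eq_zero K L _ _ (i + 1) 0 n (by simp), add_zero]
  simp

lemma tensor_d_zero_succ (j n : ℕ) (h : 0 + (j + 1) = n + 1) :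
    ιTensorObj K L 0 (j + 1) (n + 1) h ≫ (HomologicalComplex.tensorObj K L).d (n + 1) n =
      (K.X 0 ◁ L.d (j + 1) j) ≫ ιTensorObj K L 0 j n (by omega) := by
  rw [mapBifunctor.d_eq, Preadditive.comp_add, mapBifunctor.ι_D₁, mapBifunctor.ι_D₂,
    mapBifunctor.d₁_eq_zero K L _ _ 0 (j + 1) n (by simp),
    mapBifunctor.d₂_eq K L _ _ 0 (i₂ := j + 1) (i₂' := j) rfl n (by simp; omega), zero_add]
  simp

end tensor

section star

open HomologicalComplex hiding tensorObj

variable (X Y : ChainComplex (ModuleCat.{u} R) ℕ)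

/-- The complex `X_{≥ 1} ⊗ Y_{≥ 1}`. -/
abbrev truncTensor : ChainComplex (ModuleCat.{u} R) ℕ := HomologicalComplex.tensorObj (trunc X) (trunc Y)

/-- On the summand `X₁ ⊗ Y₁` of `(X_{≥ 1} ⊗ Y_{≥ 1})₂` this is `∂₁ ⊗ ∂₁`; the other summands
vanish. -/
def starAugComp : ∀ i j : ℕ, (trunc X).X i ⊗ (trunc Y).X j ⟶ X.X 0 ⊗ Y.X 0
  | 1, 1 => X.d 1 0 ⊗ₘ Y.d 1 0
  | _, _ => 0

/-- The map `∂₁ ⊗ ∂₁ : (X_{≥ 1} ⊗ Y_{≥ 1})₂ = X₁ ⊗ Y₁ ⟶ X₀ ⊗ Y₀`. -/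
def starAug : (truncTensor X Y).X 2 ⟶ X.X 0 ⊗ Y.X 0 :=
  mapBifunctorDesc (fun i j _ => starAugComp X Y i j)

lemma ι_starAug (i j : ℕ) (h : i + j = 2) :
    ιTensorObj (trunc X) (trunc Y) i j 2 h ≫ starAug X Y = starAugComp X Y i j :=
  ι_mapBifunctorDesc _ _ _ _

lemma trunc_d_succ (C : ChainComplex (ModuleCat.{u} R) ℕ) (i j : ℕ) :
    (trunc C).d (i + 1) (j + 1) = C.d (i + 1) (j + 1) :=
  ChainComplex.augment_d_succ_succ _ _ _ i j

lemma trunc_d_one_zero (C : ChainComplex (ModuleCat.{u} R) ℕ) : (trunc C).d 1 0 = 0 := rfl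

lemma isZero_trunc_tensor (C : ChainComplex (ModuleCat.{u} R) ℕ) (W : ModuleCat.{u} R) :
    Limits.IsZero ((trunc C).X 0 ⊗ W) :=
  (tensorRight W).map_isZero (ModuleCat.isZero_of_subsingleton (ModuleCat.of R PUnit))

lemma isZero_tensor_trunc (C : ChainComplex (ModuleCat.{u} R) ℕ) (W : ModuleCat.{u} R) :
    Limits.IsZero (W ⊗ (trunc C).X 0) :=
  (tensorLeft W).map_isZero (ModuleCat.isZero_of_subsingleton (ModuleCat.of R PUnit))

lemma starAug_comp : (truncTensor X Y).d 3 2 ≫ starAug X Y = 0 := by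
  refine mapBifunctor.hom_ext fun i j h => ?_
  rw [Limits.comp_zero]
  change i + j = 3 at h
  change ιTensorObj (trunc X) (trunc Y) i j 3 h ≫ _ ≫ _ = 0
  obtain _ | i := i
  · exact (isZero_trunc_tensor _ _).eq_of_src _ _
  obtain _ | j := j
  · exact (isZero_tensor_trunc _ _).eq_of_src _ _
  have e : (i = 0 ∧ j = 1) ∨ (i = 1 ∧ j = 0) := by omega
  rw [← Category.assoc, tensor_d_succ_succ, Preadditive.add_comp, Preadditive.zsmul_comp,
    Category.assoc, Category.assoc, ι_starAug, ι_starAug]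
  obtain ⟨rfl, rfl⟩ | ⟨rfl, rfl⟩ := e
  · have h0 : X.X 1 ◁ Y.d 2 1 ≫ (X.d 1 0 ⊗ₘ Y.d 1 0) = 0 := by
      rw [MonoidalCategory.tensorHom_def', ← MonoidalCategory.whiskerLeft_comp_assoc, Y.d_comp_d,
        MonoidalPreadditive.whiskerLeft_zero, Limits.zero_comp]
    rw [trunc_d_succ, show starAugComp X Y 0 (1 + 1) = 0 from rfl, Limits.comp_zero]
    refine (zero_add _).trans ((congrArg _ h0).trans (zsmul_zero _))
  · have h0 : X.d 2 1 ▷ Y.X 1 ≫ (X.d 1 0 ⊗ₘ Y.d 1 0) = 0 := by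
      rw [MonoidalCategory.tensorHom_def, ← MonoidalCategory.comp_whiskerRight_assoc, X.d_comp_d,
        MonoidalPreadditive.zero_whiskerRight, Limits.zero_comp]
    rw [trunc_d_succ, show starAugComp X Y (1 + 1) 0 = 0 from rfl, Limits.comp_zero, smul_zero,
      add_zero]
    exact h0

/-- The star product `X * Y`: it is `X₀ ⊗ Y₀` in degree `0` and `(X_{≥ 1} ⊗ Y_{≥ 1})ₙ₊₁` in degree
`n ≥ 1`, with differential `∂₁ ⊗ ∂₁` from degree `1` to degree `0` and that of
`X_{≥ 1} ⊗ Y_{≥ 1}` in higher degrees. -/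
def starProduct : ChainComplex (ModuleCat.{u} R) ℕ :=
  (ChainComplex.truncate.obj (ChainComplex.truncate.obj (truncTensor X Y))).augment
    (starAug X Y) (starAug_comp X Y)

/-- The inclusion `a ⊗ b ↦ a * b` of `Xᵢ ⊗ Yⱼ`, for `i, j ≥ 1`, into `(X * Y)ₙ`,
where `n = i + j - 1`. -/
def starι (i j n : ℕ) (h : i + 1 + (j + 1) = n + 1 + 1) :
    X.X (i + 1) ⊗ Y.X (j + 1) ⟶ (starProduct X Y).X (n + 1) :=
  ιTensorObj (trunc X) (trunc Y) (i + 1) (j + 1) (n + 2) h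

lemma starι_d_zero_zero (h : 0 + 1 + (0 + 1) = 0 + 1 + 1) :
    starι X Y 0 0 0 h ≫ (starProduct X Y).d 1 0 = X.d 1 0 ⊗ₘ Y.d 1 0 :=
  ι_starAug X Y 1 1 h

lemma starι_d_succ_succ (i j n : ℕ) (h : i + 1 + 1 + (j + 1 + 1) = n + 1 + 1 + 1) :
    starι X Y (i + 1) (j + 1) (n + 1) h ≫ (starProduct X Y).d (n + 1 + 1) (n + 1) =
      (X.d (i + 2) (i + 1) ▷ Y.X (j + 2)) ≫ starι X Y i (j + 1) n (by omega) +
        (-1 : ℤ) ^ (i + 2) • ((X.X (i + 2) ◁ Y.d (j + 2) (j + 1)) ≫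
          starι X Y (i + 1) j n (by omega)) := by
  have := tensor_d_succ_succ (trunc X) (trunc Y) (i + 1) (j + 1) (n + 2) h
  rw [trunc_d_succ, trunc_d_succ] at this
  exact this

lemma starι_d_succ_zero (i n : ℕ) (h : i + 1 + 1 + (0 + 1) = n + 1 + 1 + 1) :
    starι X Y (i + 1) 0 (n + 1) h ≫ (starProduct X Y).d (n + 1 + 1) (n + 1) =
      (X.d (i + 2) (i + 1) ▷ Y.X 1) ≫ starι X Y i 0 n (by omega) := by
  have := tensor_d_succ_succ (trunc X) (trunc Y) (i + 1) 0 (n + 2) h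
  rw [trunc_d_succ, trunc_d_one_zero, MonoidalPreadditive.whiskerLeft_zero, Limits.zero_comp,
    smul_zero, add_zero] at this
  exact this

lemma starι_d_zero_succ (j n : ℕ) (h : 0 + 1 + (j + 1 + 1) = n + 1 + 1 + 1) :
    starι X Y 0 (j + 1) (n + 1) h ≫ (starProduct X Y).d (n + 1 + 1) (n + 1) =
      -((X.X 1 ◁ Y.d (j + 2) (j + 1)) ≫ starι X Y 0 j n (by omega)) := by
  have := tensor_d_succ_succ (trunc X) (trunc Y) 0 (j + 1) (n + 2) h
  rw [trunc_d_succ, trunc_d_one_zero, MonoidalPreadditive.zero_whiskerRight, Limits.zero_comp]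
    at this
  exact this.trans ((zero_add _).trans (neg_one_zsmul _))

end star

section lift

open HomologicalComplex hiding tensorObj

variable {S T X Y : ChainComplex (ModuleCat.{u} R) ℕ}

/-- The components of `Φ` on the summands `(S_{≥ 1})ᵢ ⊗ Yⱼ`, `i + j = n + 1`, of
`(Σ⁻¹ (S_{≥ 1} ⊗ Y))ₙ`: `α ⊗ β ↦ (-1) ^ (|α| + |β|) φ α * β` for `|β| > 0`,
`α ⊗ β ↦ φ (∂ α) * β` for `|β| = 0`, `|α| = 1`, and zero for `|β| = 0`, `|α| > 1`.
When `S₀ = R = X₀` and `φ₀ = 1`, we have `φ (∂ α) = ∂ α`. -/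
def liftLeftComp (φ : S ⟶ X) (Y : ChainComplex (ModuleCat.{u} R) ℕ) :
    ∀ n i j : ℕ, i + j = n + 1 → ((trunc S).X i ⊗ Y.X j ⟶ (starProduct X Y).X n)
  | n + 1, i + 1, j + 1, h =>
      (-1 : ℤ) ^ ((i + 1) + (j + 1)) • ((φ.f (i + 1) ▷ Y.X (j + 1)) ≫ starι X Y i j n h)
  | 0, 1, 0, _ => (S.d 1 0 ≫ φ.f 0) ▷ Y.X 0
  | _, _, _, _ => 0

lemma sign_two {A : Type*} [AddCommGroup A] (u : A) :
    (-1 : ℤ) ^ (0 + 1 + (0 + 1)) • u = -((-1 : ℤ) ^ (0 + 1) • u) := by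
  simp

lemma sign_aux {A : Type*} [AddCommGroup A] (u v : A) (a b : ℕ) :
    (-1 : ℤ) ^ (a + 1 + 1 + (b + 1 + 1)) • (u + (-1 : ℤ) ^ (a + 2) • v) =
      -((-1 : ℤ) ^ (a + 1 + (b + 1 + 1)) • u +
        (-1 : ℤ) ^ (a + 1 + 1) • (-1 : ℤ) ^ (a + 1 + 1 + (b + 1)) • v) := by
  rcases neg_one_pow_eq_or ℤ a with e | e <;> rcases neg_one_pow_eq_or ℤ b with e' | e' <;>
    simp [pow_add, e, e', add_comm]

lemma sign_aux' {A : Type*} [AddCommGroup A] (u v : A) (a b : ℕ) :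
    (-1 : ℤ) ^ (a + 1 + 1 + (b + 1 + 1) - 1) • (u + (-1 : ℤ) ^ (a + 2) • v) =
      -((-1 : ℤ) ^ (a + 1 + (b + 1 + 1) - 1) • u +
        (-1 : ℤ) ^ (a + 1 + 1) • (-1 : ℤ) ^ (a + 1 + 1 + (b + 1) - 1) • v) := by
  simp only [← add_assoc, Nat.add_sub_cancel]
  rcases neg_one_pow_eq_or ℤ a with e | e <;> rcases neg_one_pow_eq_or ℤ b with e' | e' <;>
    simp [pow_add, e, e', add_comm]

lemma liftLeft_comm_zero (φ : S ⟶ X) (Y : ChainComplex (ModuleCat.{u} R) ℕ)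
    (h : 0 + 1 + (0 + 1) = 0 + 1 + 1) :
    (-1 : ℤ) ^ (0 + 1 + (0 + 1)) •
        (((φ.f 1 ▷ Y.X 1) ≫ starι X Y 0 0 0 h) ≫ (starProduct X Y).d 1 0) =
      -((-1 : ℤ) ^ (0 + 1) • ((S.X 1 ◁ Y.d 1 0) ≫ ((S.d 1 0 ≫ φ.f 0) ▷ Y.X 0))) := by
  have key : (φ.f 1 ▷ Y.X 1) ≫ (X.d 1 0 ⊗ₘ Y.d 1 0) =
      (S.X 1 ◁ Y.d 1 0) ≫ ((S.d 1 0 ≫ φ.f 0) ▷ Y.X 0) := by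
    rw [← φ.comm, MonoidalCategory.tensorHom_def, ← MonoidalCategory.comp_whiskerRight_assoc,
      ← MonoidalCategory.whisker_exchange]
  rw [Category.assoc, starι_d_zero_zero]
  exact (congrArg _ key).trans (sign_two _)

lemma liftLeft_comm_left (φ : S ⟶ X) (Y : ChainComplex (ModuleCat.{u} R) ℕ) (n : ℕ)
    (h : 0 + 1 + (n + 1 + 1) = n + 1 + 1 + 1) :
    (-1 : ℤ) ^ (0 + 1 + (n + 1 + 1)) •
        (((φ.f 1 ▷ Y.X (n + 2)) ≫ starι X Y 0 (n + 1) (n + 1) h) ≫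
          (starProduct X Y).d (n + 2) (n + 1)) =
      -((-1 : ℤ) ^ (0 + 1) • ((S.X 1 ◁ Y.d (n + 2) (n + 1)) ≫
        ((-1 : ℤ) ^ (0 + 1 + (n + 1)) • ((φ.f 1 ▷ Y.X (n + 1)) ≫
          starι X Y 0 n n (by omega))))) := by
  rw [Category.assoc, starι_d_zero_succ, Preadditive.comp_zsmul,
    MonoidalCategory.whisker_exchange_assoc, Preadditive.comp_neg]
  rcases neg_one_pow_eq_or ℤ n with e | e <;> simp [pow_add, e]

lemma liftLeft_comm_right (φ : S ⟶ X) (Y : ChainComplex (ModuleCat.{u} R) ℕ) (n : ℕ)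
    (h : n + 1 + 1 + (0 + 1) = n + 1 + 1 + 1) :
    (-1 : ℤ) ^ (n + 1 + 1 + (0 + 1)) •
        (((φ.f (n + 2) ▷ Y.X 1) ≫ starι X Y (n + 1) 0 (n + 1) h) ≫
          (starProduct X Y).d (n + 2) (n + 1)) =
      -((S.d (n + 2) (n + 1) ▷ Y.X 1) ≫
        ((-1 : ℤ) ^ (n + 1 + (0 + 1)) • ((φ.f (n + 1) ▷ Y.X 1) ≫
          starι X Y n 0 n (by omega)))) := by
  rw [Category.assoc, starι_d_succ_zero, Preadditive.comp_zsmul,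
    ← MonoidalCategory.comp_whiskerRight_assoc, ← MonoidalCategory.comp_whiskerRight_assoc,
    φ.comm]
  rcases neg_one_pow_eq_or ℤ n with e | e <;> simp [pow_add, e]

lemma liftLeft_comm_succ (φ : S ⟶ X) (Y : ChainComplex (ModuleCat.{u} R) ℕ) (a b n : ℕ)
    (h : a + 1 + 1 + (b + 1 + 1) = n + 1 + 1 + 1) :
    (-1 : ℤ) ^ (a + 1 + 1 + (b + 1 + 1)) •
        (((φ.f (a + 2) ▷ Y.X (b + 2)) ≫ starι X Y (a + 1) (b + 1) (n + 1) h) ≫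
          (starProduct X Y).d (n + 2) (n + 1)) =
      -((S.d (a + 2) (a + 1) ▷ Y.X (b + 2)) ≫
        ((-1 : ℤ) ^ (a + 1 + (b + 1 + 1)) • ((φ.f (a + 1) ▷ Y.X (b + 2)) ≫
          starι X Y a (b + 1) n (by omega))) +
        (-1 : ℤ) ^ (a + 1 + 1) • ((S.X (a + 2) ◁ Y.d (b + 2) (b + 1)) ≫
        ((-1 : ℤ) ^ (a + 1 + 1 + (b + 1)) • ((φ.f (a + 2) ▷ Y.X (b + 1)) ≫
          starι X Y (a + 1) b n (by omega))))) := by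
  rw [Category.assoc, starι_d_succ_succ, Preadditive.comp_zsmul, Preadditive.comp_zsmul,
    Preadditive.comp_add, Preadditive.comp_zsmul,
    ← MonoidalCategory.comp_whiskerRight_assoc, ← MonoidalCategory.comp_whiskerRight_assoc,
    MonoidalCategory.whisker_exchange_assoc, φ.comm]
  exact sign_aux _ _ a b

lemma liftLeft_comm (φ : S ⟶ X) (Y : ChainComplex (ModuleCat.{u} R) ℕ) (n a b : ℕ)
    (h : a + b = n + 1 + 1) :
    liftLeftComp φ Y (n + 1) a b h ≫ (starProduct X Y).d (n + 1) n =
      -(ιTensorObj (trunc S) Y a b (n + 1 + 1) h ≫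
        (HomologicalComplex.tensorObj (trunc S) Y).d (n + 1 + 1) (n + 1) ≫
          mapBifunctorDesc (fun i j h => liftLeftComp φ Y n i j h)) := by
  obtain _ | a := a
  · exact (isZero_trunc_tensor _ _).eq_of_src _ _
  obtain _ | b := b
  · rw [← Category.assoc, tensor_d_succ_zero, Category.assoc, ι_mapBifunctorDesc]
    obtain rfl : a = n + 1 := by omega
    rw [trunc_d_succ]
    obtain _ | n := n
    · have h0 : S.d 2 1 ▷ Y.X 0 ≫ (S.d 1 0 ≫ φ.f 0) ▷ Y.X 0 = 0 := by
        rw [← MonoidalCategory.comp_whiskerRight, S.d_comp_d_assoc, Limits.zero_comp,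
          MonoidalPreadditive.zero_whiskerRight]
      exact Limits.zero_comp.trans (neg_eq_zero.mpr h0).symm
    · exact Limits.zero_comp.trans (neg_eq_zero.mpr Limits.comp_zero).symm
  rw [← Category.assoc, tensor_d_succ_succ, Preadditive.add_comp, Preadditive.zsmul_comp,
    Category.assoc, Category.assoc, ι_mapBifunctorDesc, ι_mapBifunctorDesc]
  refine (Preadditive.zsmul_comp _ _ _).trans ?_
  obtain _ | n := n
  · obtain rfl : a = 0 := by omega
    obtain rfl : b = 0 := by omega
    rw [trunc_d_one_zero, MonoidalPreadditive.zero_whiskerRight, Limits.zero_comp]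
    exact (liftLeft_comm_zero φ Y h).trans (congrArg _ (zero_add _).symm)
  obtain _ | a := a
  · obtain rfl : b = n + 1 := by omega
    rw [trunc_d_one_zero, MonoidalPreadditive.zero_whiskerRight, Limits.zero_comp]
    exact (liftLeft_comm_left φ Y n h).trans (congrArg _ (zero_add _).symm)
  rw [trunc_d_succ]
  obtain _ | b := b
  · obtain rfl : a = n := by omega
    refine (liftLeft_comm_right φ Y a h).trans (congrArg _ ((add_zero _).symm.trans ?_))
    exact congrArg _ ((congrArg _ Limits.comp_zero).trans (zsmul_zero _)).symm
  · exact liftLeft_comm_succ φ Y a b n h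

/-- The chain map `Φ : Σ⁻¹ (S_{≥ 1} ⊗ Y) ⟶ X * Y` attached to `φ : S ⟶ X`. -/
def liftLeft (φ : S ⟶ X) (Y : ChainComplex (ModuleCat.{u} R) ℕ) :
    desusp (HomologicalComplex.tensorObj (trunc S) Y) ⟶ starProduct X Y where
  f n := mapBifunctorDesc (fun i j h => liftLeftComp φ Y n i j h)
  comm' := by
    rintro _ n rfl
    refine mapBifunctor.hom_ext fun a b h => ?_
    refine (Category.assoc _ _ _).symm.trans ?_
    refine (congrArg (· ≫ _) (ι_mapBifunctorDesc _ a b h)).trans ?_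
    refine (liftLeft_comm φ Y n a b h).trans ?_
    change _ = ιTensorObj (trunc S) Y a b (n + 1 + 1) h ≫
      (-(HomologicalComplex.tensorObj (trunc S) Y).d (n + 1 + 1) (n + 1)) ≫ _
    rw [Preadditive.neg_comp, Preadditive.comp_neg]

/-- The components of `Ψ` on the summands `Xᵢ ⊗ (T_{≥ 1})ⱼ`, `i + j = n + 1`, of
`(Σ⁻¹ (X ⊗ T_{≥ 1}))ₙ`: `α ⊗ β ↦ (-1) ^ (|α| + |β| - 1) α * ψ β` for `|α| > 0`,
`α ⊗ β ↦ α * ψ (∂ β)` for `|α| = 0`, `|β| = 1`, and zero for `|α| = 0`, `|β| > 1`.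
When `T₀ = R = Y₀` and `ψ₀ = 1`, we have `ψ (∂ β) = ∂ β`. -/
def liftRightComp (X : ChainComplex (ModuleCat.{u} R) ℕ) (ψ : T ⟶ Y) :
    ∀ n i j : ℕ, i + j = n + 1 → (X.X i ⊗ (trunc T).X j ⟶ (starProduct X Y).X n)
  | n + 1, i + 1, j + 1, h =>
      (-1 : ℤ) ^ ((i + 1) + (j + 1) - 1) • ((X.X (i + 1) ◁ ψ.f (j + 1)) ≫ starι X Y i j n h)
  | 0, 0, 1, _ => X.X 0 ◁ (T.d 1 0 ≫ ψ.f 0)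
  | _, _, _, _ => 0

lemma liftRight_comm_zero (X : ChainComplex (ModuleCat.{u} R) ℕ) (ψ : T ⟶ Y)
    (h : 0 + 1 + (0 + 1) = 0 + 1 + 1) :
    (-1 : ℤ) ^ (0 + 1 + (0 + 1) - 1) •
        (((X.X 1 ◁ ψ.f 1) ≫ starι X Y 0 0 0 h) ≫ (starProduct X Y).d 1 0) =
      -((X.d 1 0 ▷ T.X 1) ≫ (X.X 0 ◁ (T.d 1 0 ≫ ψ.f 0))) := by
  have key : (X.X 1 ◁ ψ.f 1) ≫ (X.d 1 0 ⊗ₘ Y.d 1 0) =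
      (X.d 1 0 ▷ T.X 1) ≫ (X.X 0 ◁ (T.d 1 0 ≫ ψ.f 0)) := by
    rw [← ψ.comm, MonoidalCategory.tensorHom_def', ← MonoidalCategory.whiskerLeft_comp_assoc,
      MonoidalCategory.whisker_exchange]
  rw [Category.assoc, starι_d_zero_zero]
  exact (congrArg _ key).trans (neg_one_zsmul _)

lemma liftRight_comm_left (X : ChainComplex (ModuleCat.{u} R) ℕ) (ψ : T ⟶ Y) (n : ℕ)
    (h : 0 + 1 + (n + 1 + 1) = n + 1 + 1 + 1) :
    (-1 : ℤ) ^ (0 + 1 + (n + 1 + 1) - 1) •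
        (((X.X 1 ◁ ψ.f (n + 2)) ≫ starι X Y 0 (n + 1) (n + 1) h) ≫
          (starProduct X Y).d (n + 2) (n + 1)) =
      -((-1 : ℤ) ^ (0 + 1) • ((X.X 1 ◁ T.d (n + 2) (n + 1)) ≫
        ((-1 : ℤ) ^ (0 + 1 + (n + 1) - 1) • ((X.X 1 ◁ ψ.f (n + 1)) ≫
          starι X Y 0 n n (by omega))))) := by
  rw [Category.assoc, starι_d_zero_succ, Preadditive.comp_zsmul, Preadditive.comp_neg,
    ← MonoidalCategory.whiskerLeft_comp_assoc, ← MonoidalCategory.whiskerLeft_comp_assoc, ψ.comm]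
  simp only [← add_assoc, Nat.add_sub_cancel]
  rcases neg_one_pow_eq_or ℤ n with e | e <;> simp [pow_add, e]

lemma liftRight_comm_right (X : ChainComplex (ModuleCat.{u} R) ℕ) (ψ : T ⟶ Y) (n : ℕ)
    (h : n + 1 + 1 + (0 + 1) = n + 1 + 1 + 1) :
    (-1 : ℤ) ^ (n + 1 + 1 + (0 + 1) - 1) •
        (((X.X (n + 2) ◁ ψ.f 1) ≫ starι X Y (n + 1) 0 (n + 1) h) ≫
          (starProduct X Y).d (n + 2) (n + 1)) =
      -((X.d (n + 2) (n + 1) ▷ T.X 1) ≫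
        ((-1 : ℤ) ^ (n + 1 + (0 + 1) - 1) • ((X.X (n + 1) ◁ ψ.f 1) ≫
          starι X Y n 0 n (by omega)))) := by
  rw [Category.assoc, starι_d_succ_zero, Preadditive.comp_zsmul,
    ← MonoidalCategory.whisker_exchange_assoc]
  simp only [← add_assoc, Nat.add_sub_cancel]
  rcases neg_one_pow_eq_or ℤ n with e | e <;> simp [pow_add, e]

lemma liftRight_comm_succ (X : ChainComplex (ModuleCat.{u} R) ℕ) (ψ : T ⟶ Y) (a b n : ℕ)
    (h : a + 1 + 1 + (b + 1 + 1) = n + 1 + 1 + 1) :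
    (-1 : ℤ) ^ (a + 1 + 1 + (b + 1 + 1) - 1) •
        (((X.X (a + 2) ◁ ψ.f (b + 2)) ≫ starι X Y (a + 1) (b + 1) (n + 1) h) ≫
          (starProduct X Y).d (n + 2) (n + 1)) =
      -((X.d (a + 2) (a + 1) ▷ T.X (b + 2)) ≫
        ((-1 : ℤ) ^ (a + 1 + (b + 1 + 1) - 1) • ((X.X (a + 1) ◁ ψ.f (b + 2)) ≫
          starι X Y a (b + 1) n (by omega))) +
        (-1 : ℤ) ^ (a + 1 + 1) • ((X.X (a + 2) ◁ T.d (b + 2) (b + 1)) ≫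
        ((-1 : ℤ) ^ (a + 1 + 1 + (b + 1) - 1) • ((X.X (a + 2) ◁ ψ.f (b + 1)) ≫
          starι X Y (a + 1) b n (by omega))))) := by
  rw [Category.assoc, starι_d_succ_succ, Preadditive.comp_zsmul, Preadditive.comp_zsmul,
    Preadditive.comp_add, Preadditive.comp_zsmul,
    ← MonoidalCategory.whiskerLeft_comp_assoc, ← MonoidalCategory.whiskerLeft_comp_assoc,
    ← MonoidalCategory.whisker_exchange_assoc, ψ.comm]
  exact sign_aux' _ _ a b

lemma liftRight_comm (X : ChainComplex (ModuleCat.{u} R) ℕ) (ψ : T ⟶ Y) (n a b : ℕ)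
    (h : a + b = n + 1 + 1) :
    liftRightComp X ψ (n + 1) a b h ≫ (starProduct X Y).d (n + 1) n =
      -(ιTensorObj X (trunc T) a b (n + 1 + 1) h ≫
        (HomologicalComplex.tensorObj X (trunc T)).d (n + 1 + 1) (n + 1) ≫
          mapBifunctorDesc (fun i j h => liftRightComp X ψ n i j h)) := by
  obtain _ | b := b
  · exact (isZero_tensor_trunc _ _).eq_of_src _ _
  obtain _ | a := a
  · rw [← Category.assoc, tensor_d_zero_succ, Category.assoc, ι_mapBifunctorDesc]
    obtain rfl : b = n + 1 := by omega
    rw [trunc_d_succ]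
    obtain _ | n := n
    · have h0 : X.X 0 ◁ T.d 2 1 ≫ X.X 0 ◁ (T.d 1 0 ≫ ψ.f 0) = 0 := by
        rw [← MonoidalCategory.whiskerLeft_comp, T.d_comp_d_assoc, Limits.zero_comp,
          MonoidalPreadditive.whiskerLeft_zero]
      exact Limits.zero_comp.trans (neg_eq_zero.mpr h0).symm
    · exact Limits.zero_comp.trans (neg_eq_zero.mpr Limits.comp_zero).symm
  rw [← Category.assoc, tensor_d_succ_succ, Preadditive.add_comp, Preadditive.zsmul_comp,
    Category.assoc, Category.assoc, ι_mapBifunctorDesc, ι_mapBifunctorDesc]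
  refine (Preadditive.zsmul_comp _ _ _).trans ?_
  obtain _ | n := n
  · obtain rfl : a = 0 := by omega
    obtain rfl : b = 0 := by omega
    rw [trunc_d_one_zero, MonoidalPreadditive.whiskerLeft_zero, Limits.zero_comp, zsmul_zero]
    exact (liftRight_comm_zero X ψ h).trans (congrArg _ (add_zero _).symm)
  obtain _ | b := b
  · obtain rfl : a = n + 1 := by omega
    rw [trunc_d_one_zero, MonoidalPreadditive.whiskerLeft_zero, Limits.zero_comp, zsmul_zero]
    exact (liftRight_comm_right X ψ n h).trans (congrArg _ (add_zero _).symm)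
  rw [trunc_d_succ]
  obtain _ | a := a
  · obtain rfl : b = n := by omega
    refine (liftRight_comm_left X ψ b h).trans (congrArg _ ((zero_add _).symm.trans ?_))
    exact congrArg (· + _) Limits.comp_zero.symm
  · exact liftRight_comm_succ X ψ a b n h

/-- The chain map `Ψ : Σ⁻¹ (X ⊗ T_{≥ 1}) ⟶ X * Y` attached to `ψ : T ⟶ Y`. -/
def liftRight (X : ChainComplex (ModuleCat.{u} R) ℕ) (ψ : T ⟶ Y) :
    desusp (HomologicalComplex.tensorObj X (trunc T)) ⟶ starProduct X Y where
  f n := mapBifunctorDesc (fun i j h => liftRightComp X ψ n i j h)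
  comm' := by
    rintro _ n rfl
    refine mapBifunctor.hom_ext fun a b h => ?_
    refine (Category.assoc _ _ _).symm.trans ?_
    refine (congrArg (· ≫ _) (ι_mapBifunctorDesc _ a b h)).trans ?_
    refine (liftRight_comm X ψ n a b h).trans ?_
    change _ = ιTensorObj X (trunc T) a b (n + 1 + 1) h ≫
      (-(HomologicalComplex.tensorObj X (trunc T)).d (n + 1 + 1) (n + 1)) ≫ _
    rw [Preadditive.neg_comp, Preadditive.comp_neg]

/-- The mapping cone `Cone(f)`: it is `Bᵢ ⊕ Aᵢ₋₁` in degree `i`, with differential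
`(b, a) ↦ (∂ b + f a, -∂ a)`. -/
abbrev cone {A B : ChainComplex (ModuleCat.{u} R) ℕ} (f : A ⟶ B) :
    ChainComplex (ModuleCat.{u} R) ℕ :=
  homotopyCofiber f

end lift

end

end StarCone

/-! By the long exact sequence of a mapping cone, `Cone(Φ)` is acyclic in positive degrees once `X *
Y` and the source of `Φ` are acyclic in positive degrees and `Φ` is injective on `H₀`; `cone_exact`
is the elementwise form. It then remains to compute the image of `∂₁` in `R`.

Acyclicity: the columns `K ⊗ Lⱼ` of a tensor product with `L` free and `K` either `X` or `X_{≥ 1}`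
are exact above the bottom degree of `K`. So the total complex has the homology of its complex of
bottom cokernels (`tensor_exact_of_columns`). The cokernels are `R/I ⊗ L` for `K = X` and `I ⊗ L`
for `K = X_{≥ 1}`. Tor-independence makes `R/I ⊗ Y` acyclic in positive degrees (`exists_eq_zero`),
and a dimension shift along `0 → I → R → R/I → 0` does the same for `I ⊗ Y` (`exists_eq_one`).
Truncating `Y` changes nothing in high degrees. Degree 1 of `X * Y`, where the differential is `∂₁ ⊗
∂₁`, is treated by hand and again reduces to `I ⊗ Y`.

Injectivity on `H₀`: for `Φ` the map is `I' ⊗ R/J = I'/I'J → R/IJ`, and `I' ∩ IJ ⊆ I' ∩ J = I'J`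
because `Tor₁(R/I', R/J) = 0`. For `Ψ` it is `R/I ⊗ J' → R/IJ`, with `Tor₁(R/I, R/J') = 0` in the
same role.

Image of `∂₁`: the star product contributes `IJ`, and `Φ₀`, `Ψ₀` contribute `I'`, `J'`. -/

namespace StarCone

noncomputable section

variable {R : Type u} [CommRing R]

/-! ### Coordinates on the total tensor product -/

section coordinates

open HomologicalComplex hiding tensorObj

variable (K L : ChainComplex (ModuleCat.{u} R) ℕ)

/-- The projection of `(K ⊗ L)ₙ` onto its summand `Kᵢ ⊗ Lⱼ`. -/
def tensorπ (i j n : ℕ) (h : i + j = n) :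
    (HomologicalComplex.tensorObj K L).X n ⟶ K.X i ⊗ L.X j :=
  mapBifunctorDesc (fun i' j' (h' : i' + j' = n) =>
    -- Testing the first index suffices, since the total degree `n` determines the second.
    if e : i' = i then eqToHom (by obtain rfl : j' = j := by omega
                                   rw [e]; rfl) else 0)

lemma ι_tensorπ_self (i j n : ℕ) (h : i + j = n) :
    ιTensorObj K L i j n h ≫ tensorπ K L i j n h = 𝟙 _ := by
  refine (ι_mapBifunctorDesc _ _ _ _).trans ?_
  simp

lemma ι_tensorπ_of_ne (i j i' j' n : ℕ) (h : i + j = n) (h' : i' + j' = n) (e : i' ≠ i) :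
    ιTensorObj K L i' j' n h' ≫ tensorπ K L i j n h = 0 := by
  refine (ι_mapBifunctorDesc _ _ _ _).trans ?_
  simp [e]

/-- Only two summands map to `Kᵢ ⊗ Lⱼ`: its neighbours `Kᵢ₊₁ ⊗ Lⱼ` and `Kᵢ ⊗ Lⱼ₊₁`. This turns the
cycle condition into one equation per bidegree, the form used in every diagram chase below. -/
lemma d_tensorπ (i j n : ℕ) (h : i + j = n) :
    (HomologicalComplex.tensorObj K L).d (n + 1) n ≫ tensorπ K L i j n h =
      tensorπ K L (i + 1) j (n + 1) (by omega) ≫ (K.d (i + 1) i ▷ L.X j) +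
        (-1 : ℤ) ^ i • (tensorπ K L i (j + 1) (n + 1) (by omega) ≫ (K.X i ◁ L.d (j + 1) j)) := by
  refine mapBifunctor.hom_ext fun a b hab => ?_
  change a + b = n + 1 at hab
  change ιTensorObj K L a b (n + 1) hab ≫ _ ≫ _ = ιTensorObj K L a b (n + 1) hab ≫ _
  rw [Preadditive.comp_add, Preadditive.comp_zsmul, ← Category.assoc, ← Category.assoc,
    ← Category.assoc]
  by_cases e1 : a = i + 1
  · subst e1
    obtain rfl : b = j := by omega
    rw [ι_tensorπ_self, ι_tensorπ_of_ne _ _ _ _ _ _ _ _ _ (by omega), Limits.zero_comp, smul_zero,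
      add_zero, Category.id_comp]
    obtain _ | b := b
    · rw [tensor_d_succ_zero, Category.assoc, ι_tensorπ_self, Category.comp_id]
    · rw [tensor_d_succ_succ, Preadditive.add_comp, Category.assoc, ι_tensorπ_self,
        Category.comp_id, Preadditive.zsmul_comp, Category.assoc,
        ι_tensorπ_of_ne _ _ _ _ _ _ _ _ _ (by omega), Limits.comp_zero, smul_zero, add_zero]
  rw [ι_tensorπ_of_ne _ _ _ _ _ _ _ _ _ e1, Limits.zero_comp, zero_add]
  by_cases e2 : a = i
  · subst e2
    obtain rfl : b = j + 1 := by omega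
    rw [ι_tensorπ_self, Category.id_comp]
    obtain _ | a := a
    · rw [tensor_d_zero_succ, Category.assoc, ι_tensorπ_self, Category.comp_id]
      simp
    · rw [tensor_d_succ_succ, Preadditive.add_comp, Category.assoc,
        ι_tensorπ_of_ne _ _ _ _ _ _ _ _ _ (by omega),
        Preadditive.zsmul_comp, Category.assoc, ι_tensorπ_self,
        Category.comp_id, Limits.comp_zero, zero_add]
  rw [ι_tensorπ_of_ne _ _ _ _ _ _ _ _ _ e2, Limits.zero_comp, smul_zero]
  obtain _ | a := a
  · obtain _ | b := b
    · omega
    rw [tensor_d_zero_succ, Category.assoc, ι_tensorπ_of_ne _ _ _ _ _ _ _ _ _ (by omega),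
      Limits.comp_zero]
  obtain _ | b := b
  · rw [tensor_d_succ_zero, Category.assoc, ι_tensorπ_of_ne _ _ _ _ _ _ _ _ _ (by omega),
      Limits.comp_zero]
  rw [tensor_d_succ_succ, Preadditive.add_comp, Preadditive.zsmul_comp, Category.assoc,
    Category.assoc, ι_tensorπ_of_ne _ _ _ _ _ _ _ _ _ (by omega),
    ι_tensorπ_of_ne _ _ _ _ _ _ _ _ _ (by omega)]
  simp

lemma sum_tensorπ_ι (n : ℕ) :
    ∑ p : Finset.HasAntidiagonal.antidiagonal n, tensorπ K L p.1.1 p.1.2 n (Finset.HasAntidiagonal.mem_antidiagonal.1 p.2) ≫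
      ιTensorObj K L p.1.1 p.1.2 n (Finset.HasAntidiagonal.mem_antidiagonal.1 p.2) = 𝟙 _ := by
  refine mapBifunctor.hom_ext fun a b hab => ?_
  change a + b = n at hab
  change ιTensorObj K L a b n hab ≫ _ = ιTensorObj K L a b n hab ≫ _
  rw [Preadditive.comp_sum, Finset.sum_eq_single ⟨(a, b), Finset.HasAntidiagonal.mem_antidiagonal.2 hab⟩]
  · rw [← Category.assoc, ι_tensorπ_self, Category.id_comp, Category.comp_id]
  · rintro ⟨⟨a', b'⟩, h'⟩ _ hne
    rw [Finset.HasAntidiagonal.mem_antidiagonal] at h'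
    rw [← Category.assoc, ι_tensorπ_of_ne, Limits.zero_comp]
    rintro rfl
    exact hne (Subtype.ext (Prod.ext rfl (by simp at h' ⊢; omega)))
  · simp

variable {K L}

lemma tensor_eq_zero {n : ℕ} (z : (HomologicalComplex.tensorObj K L).X n)
    (hz : ∀ i j (h : i + j = n), (tensorπ K L i j n h).hom z = 0) : z = 0 := by
  have := congrArg (fun f => f.hom z) (sum_tensorπ_ι K L n)
  simp only [ModuleCat.hom_sum, ModuleCat.hom_comp, LinearMap.sum_apply, LinearMap.comp_apply,
    hz, map_zero, Finset.sum_const_zero] at this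
  exact this.symm

lemma tensorπ_ι_self {i j n : ℕ} (h : i + j = n) (x : (K.X i ⊗ L.X j : ModuleCat R)) :
    (tensorπ K L i j n h).hom ((ιTensorObj K L i j n h).hom x) = x :=
  congrArg (fun f => f.hom x) (ι_tensorπ_self K L i j n h)

lemma tensorπ_ι_of_ne {i j i' j' n : ℕ} (h : i + j = n) (h' : i' + j' = n) (e : i' ≠ i)
    (x : (K.X i' ⊗ L.X j' : ModuleCat R)) :
    (tensorπ K L i j n h).hom ((ιTensorObj K L i' j' n h').hom x) = 0 :=
  congrArg (fun f => f.hom x) (ι_tensorπ_of_ne K L i j i' j' n h h' e)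

lemma tensorπ_d {i j n : ℕ} (h : i + j = n) (z : (HomologicalComplex.tensorObj K L).X (n + 1)) :
    (tensorπ K L i j n h).hom (((HomologicalComplex.tensorObj K L).d (n + 1) n).hom z) =
      (K.d (i + 1) i ▷ L.X j).hom ((tensorπ K L (i + 1) j (n + 1) (by omega)).hom z) +
        (-1 : ℤ) ^ i • (K.X i ◁ L.d (j + 1) j).hom
          ((tensorπ K L i (j + 1) (n + 1) (by omega)).hom z) := by
  have := congrArg (fun f => f.hom z) (d_tensorπ K L i j n h)
  simpa using this

lemma tensor_d_d {n : ℕ} (w : (HomologicalComplex.tensorObj K L).X (n + 2)) :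
    ((HomologicalComplex.tensorObj K L).d (n + 1) n).hom
      (((HomologicalComplex.tensorObj K L).d (n + 2) (n + 1)).hom w) = 0 :=
  congrArg (fun f => f.hom w) ((HomologicalComplex.tensorObj K L).d_comp_d (n + 2) (n + 1) n)

/-- `(K ⊗ L)ₙ` is the finite product of the `Kᵢ ⊗ Lⱼ` with `i + j = n`. -/
def tensorObjEquiv (n : ℕ) : (HomologicalComplex.tensorObj K L).X n ≃ₗ[R]
    ∀ p : Finset.HasAntidiagonal.antidiagonal n, (K.X p.1.1 ⊗ L.X p.1.2 : ModuleCat R) where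
  toFun z p := (tensorπ K L p.1.1 p.1.2 n (Finset.HasAntidiagonal.mem_antidiagonal.1 p.2)).hom z
  map_add' _ _ := by ext; simp
  map_smul' _ _ := by ext; simp
  invFun x := ∑ p, (ιTensorObj K L p.1.1 p.1.2 n (Finset.HasAntidiagonal.mem_antidiagonal.1 p.2)).hom (x p)
  left_inv z := by
    simpa using congrArg (fun f => f.hom z) (sum_tensorπ_ι K L n)
  right_inv x := by
    funext p
    refine (map_sum _ _ _).trans ?_
    rw [Finset.sum_eq_single p]
    · exact tensorπ_ι_self _ _
    · intro q _ hne
      refine tensorπ_ι_of_ne _ _ (fun e => hne (Subtype.ext (Prod.ext e ?_))) _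
      have h1 := Finset.HasAntidiagonal.mem_antidiagonal.1 p.2
      have h2 := Finset.HasAntidiagonal.mem_antidiagonal.1 q.2
      omega
    · simp

lemma free_tensorObj (hK : ∀ n, Module.Free R (K.X n)) (hL : ∀ n, Module.Free R (L.X n)) (n : ℕ) :
    Module.Free R ((HomologicalComplex.tensorObj K L).X n) := by
  have : ∀ p : Finset.HasAntidiagonal.antidiagonal n, Module.Free R (K.X p.1.1 ⊗ L.X p.1.2 : ModuleCat R) :=
    fun p => by
      have := hK p.1.1
      have := hL p.1.2
      exact inferInstanceAs (Module.Free R (TensorProduct R (K.X p.1.1) (L.X p.1.2)))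
  exact Module.Free.of_equiv (tensorObjEquiv n).symm

end coordinates

/-! ### Tor computed from a free resolution -/

section resolution

variable {C : ChainComplex (ModuleCat.{u} R) ℕ} {M : Type u} [AddCommGroup M] [Module R M]
  {ε : C.X 0 →ₗ[R] M}

/-- A free resolution, as a projective resolution in the sense of Mathlib. -/
def IsFreeResolution.projectiveResolution (hC : IsFreeResolution C ε) :
    ProjectiveResolution (ModuleCat.of R M) where
  complex := C
  projective n := by
    have := hC.free n
    have : Module.Projective R (C.X n) := Module.Projective.of_free
    exact (IsProjective.iff_projective (C.X n)).1 this
  π := (ChainComplex.toSingle₀Equiv C (ModuleCat.of R M)).symm ⟨ModuleCat.ofHom ε, by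
    ext x
    exact hC.exact_zero.apply_apply_eq_zero x⟩
  quasiIso := ⟨fun n => by
    cases n with
    | zero =>
      rw [ChainComplex.quasiIsoAt₀_iff, ShortComplex.quasiIso_iff_of_zeros' _
        (C.shape _ _ (by simp)) rfl rfl]
      constructor
      · rw [ShortComplex.moduleCat_exact_iff]
        intro x hx
        exact (hC.exact_zero x).1 (by simpa [ChainComplex.toSingle₀Equiv] using! hx)
      · rw [ModuleCat.epi_iff_surjective]
        intro x
        obtain ⟨y, hy⟩ := hC.surjective x
        exact ⟨y, by simpa [ChainComplex.toSingle₀Equiv] using! hy⟩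
    | succ n =>
      rw [quasiIsoAt_iff_exactAt' (hL := ChainComplex.exactAt_succ_single_obj ..),
          HomologicalComplex.exactAt_iff' _ (n + 2) (n + 1) n (by simp) (by simp),
          ShortComplex.moduleCat_exact_iff]
      intro x hx
      exact (hC.exact_succ n x).1 hx⟩

/-- `Tor` is the left derived functor of `R/I ⊗ -`, so it is the homology of `R/I ⊗ Y` for the given
resolution `Y` of `R/J`. -/
lemma TorIndependent.exact_lTensor {I J : Ideal R} (h : TorIndependent I J)
    {Y : ChainComplex (ModuleCat.{u} R) ℕ} {ε : Y.X 0 →ₗ[R] R ⧸ J} (hY : IsFreeResolution Y ε)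
    (n : ℕ) :
    Function.Exact ((Y.d (n + 2) (n + 1)).hom.lTensor (R ⧸ I))
      ((Y.d (n + 1) n).hom.lTensor (R ⧸ I)) := by
  have h1 := (h (n + 1) (by omega)).of_iso
    (hY.projectiveResolution.isoLeftDerivedObj
      ((tensoringLeft (ModuleCat.{u} R)).obj (ModuleCat.of R (R ⧸ I))) (n + 1)).symm
  replace h1 := (HomologicalComplex.exactAt_iff_isZero_homology _ _).2 h1
  rw [HomologicalComplex.exactAt_iff' _ (n + 2) (n + 1) n (by simp) (by simp)] at h1
  rw [ShortComplex.moduleCat_exact_iff] at h1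
  intro x
  refine ⟨fun hx => h1 x hx, ?_⟩
  rintro ⟨y, rfl⟩
  rw [← LinearMap.comp_apply, ← LinearMap.lTensor_comp, ← ModuleCat.hom_comp, Y.d_comp_d]
  simp

end resolution

/-! ### Total complexes with exact columns -/

section columns

open HomologicalComplex hiding tensorObj

variable {K L : ChainComplex (ModuleCat.{u} R) ℕ}

lemma tensorπ_d_ι_of_lt {a b n : ℕ} (h : a + b = n + 1) (u : (K.X a ⊗ L.X b : ModuleCat R))
    {i j : ℕ} (hij : i + j = n) (hj : b < j) :
    (tensorπ K L i j n hij).hom (((HomologicalComplex.tensorObj K L).d (n + 1) n).hom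
      ((ιTensorObj K L a b (n + 1) h).hom u)) = 0 := by
  rw [tensorπ_d, tensorπ_ι_of_ne _ _ (by omega), tensorπ_ι_of_ne _ _ (by omega), map_zero,
    map_zero, smul_zero, add_zero]

lemma tensorπ_d_ι_left {i j n : ℕ} (h : i + j = n) (h' : i + 1 + j = n + 1)
    (u : (K.X (i + 1) ⊗ L.X j : ModuleCat R)) :
    (tensorπ K L i j n h).hom (((HomologicalComplex.tensorObj K L).d (n + 1) n).hom
      ((ιTensorObj K L (i + 1) j (n + 1) h').hom u)) = (K.d (i + 1) i ▷ L.X j).hom u := by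
  rw [tensorπ_d, tensorπ_ι_self, tensorπ_ι_of_ne _ _ (by omega), map_zero, smul_zero, add_zero]

lemma tensorπ_d_ι_right {i j n : ℕ} (h : i + j = n) (h' : i + (j + 1) = n + 1)
    (u : (K.X i ⊗ L.X (j + 1) : ModuleCat R)) :
    (tensorπ K L i j n h).hom (((HomologicalComplex.tensorObj K L).d (n + 1) n).hom
      ((ιTensorObj K L i (j + 1) (n + 1) h').hom u)) =
        (-1 : ℤ) ^ i • (K.X i ◁ L.d (j + 1) j).hom u := by
  rw [tensorπ_d, tensorπ_ι_self, tensorπ_ι_of_ne _ _ (by omega), map_zero, zero_add]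

/-- If the columns `K ⊗ Lⱼ` are exact above degree `a`, then a cycle of degree `n + 1` whose
components in `Kᵢ ⊗ Lⱼ` vanish for all `i ≤ a` is a boundary. -/
lemma tensor_mem_range_of_columns {a n : ℕ}
    (hv : ∀ i j, a ≤ i →
      Function.Exact (K.d (i + 2) (i + 1) ▷ L.X j).hom (K.d (i + 1) i ▷ L.X j).hom)
    (k : ℕ) (hk : a + k ≤ n + 1) (z : (HomologicalComplex.tensorObj K L).X (n + 1))
    (hz : ((HomologicalComplex.tensorObj K L).d (n + 1) n).hom z = 0)
    (hzk : ∀ i j (h : i + j = n + 1), k ≤ j → (tensorπ K L i j (n + 1) h).hom z = 0) :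
    ∃ w, ((HomologicalComplex.tensorObj K L).d (n + 2) (n + 1)).hom w = z := by
  induction k generalizing z with
  | zero => exact ⟨0, by rw [map_zero, tensor_eq_zero z fun i j h => hzk i j h (Nat.zero_le _)]⟩
  | succ k ih =>
    -- The component to be removed is the one in `Kᵢ₊₁ ⊗ Lₖ`. The components with second index above
    -- `k` vanish, so it is a vertical cycle, and `hk` gives `a ≤ i`, so its column is exact there.
    obtain ⟨i, hi⟩ : ∃ i, n = i + k := ⟨n - k, by omega⟩
    have h0 : (K.d (i + 1) i ▷ L.X k).hom ((tensorπ K L (i + 1) k (n + 1) (by omega)).hom z) = 0 := by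
      have := tensorπ_d (show i + k = n by omega) z
      rw [hz, hzk i (k + 1) _ le_rfl, map_zero, map_zero, smul_zero, add_zero] at this
      exact this.symm
    -- The boundary of `u` cancels this component and otherwise only affects second index `k - 1`,
    -- so the components already killed stay zero.
    obtain ⟨u, hu⟩ := (hv i k (by omega) _).1 h0
    obtain ⟨w, hw⟩ := ih (by omega)
      (z - ((HomologicalComplex.tensorObj K L).d (n + 2) (n + 1)).hom
        ((ιTensorObj K L (i + 2) k (n + 2) (by omega)).hom u))
      (by rw [map_sub, hz, tensor_d_d, sub_zero]) fun i' j' h' hj' => by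
        obtain hj' | rfl := hj'.lt_or_eq
        · rw [map_sub, tensorπ_d_ι_of_lt _ _ _ hj', hzk i' j' h' hj', sub_zero]
        · obtain rfl : i' = i + 1 := by omega
          rw [map_sub, tensorπ_d_ι_left, hu, sub_self]
    exact ⟨w + (ιTensorObj K L (i + 2) k (n + 2) (by omega)).hom u, by
      rw [map_add, hw, sub_add_cancel]⟩

/-- If the columns `K ⊗ Lⱼ` vanish below degree `a` and are exact above degree `a`, then the
homology of `K ⊗ L` in degree `a + m + 1` vanishes as soon as the complex of the cokernels of
`Kₐ₊₁ ⊗ Lⱼ ⟶ Kₐ ⊗ Lⱼ` is exact in degree `m + 1`. -/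
lemma tensor_exact_of_columns {a m n : ℕ} (hn : a + m = n) (h0 : ∀ i < a, Subsingleton (K.X i))
    (hv : ∀ i j, a ≤ i →
      Function.Exact (K.d (i + 2) (i + 1) ▷ L.X j).hom (K.d (i + 1) i ▷ L.X j).hom)
    (hT : ∀ x : (K.X a ⊗ L.X (m + 1) : ModuleCat R),
      (∃ u, (K.d (a + 1) a ▷ L.X m).hom u = (K.X a ◁ L.d (m + 1) m).hom x) →
      ∃ y w, x = (K.X a ◁ L.d (m + 2) (m + 1)).hom y + (K.d (a + 1) a ▷ L.X (m + 1)).hom w) :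
    Function.Exact ((HomologicalComplex.tensorObj K L).d (n + 2) (n + 1)).hom
      ((HomologicalComplex.tensorObj K L).d (n + 1) n).hom := by
  subst hn
  intro z
  refine ⟨fun hz => ?_, by rintro ⟨w, rfl⟩; exact tensor_d_d w⟩
  have h1 := tensorπ_d (show a + m = a + m from rfl) z
  rw [hz, map_zero] at h1
  obtain ⟨y, w, hyw⟩ := hT ((tensorπ K L a (m + 1) (a + m + 1) (by omega)).hom z)
    -- The `(a, m)` component of `∂z = 0` says that the bottom component of `z` is a cycle modulo
    -- the vertical image; this is the explicit witness.
    ⟨-(-1 : ℤ) ^ a • (tensorπ K L (a + 1) m (a + m + 1) (by omega)).hom z, by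
      rw [map_zsmul, eq_neg_of_add_eq_zero_left h1.symm, smul_neg, neg_smul, neg_neg, smul_smul,
        ← mul_pow]
      simp⟩
  -- The factor `(-1) ^ a` on `y` cancels the Koszul sign, so `z - ∂v` has zero component in `Kₐ ⊗
  -- Lₘ₊₁`.
  set v := (ιTensorObj K L a (m + 2) (a + m + 2) (by omega)).hom ((-1 : ℤ) ^ a • y) +
    (ιTensorObj K L (a + 1) (m + 1) (a + m + 2) (by omega)).hom w with hv'
  obtain ⟨w', hw'⟩ := tensor_mem_range_of_columns hv (m + 1) (by omega)
    (z - ((HomologicalComplex.tensorObj K L).d (a + m + 2) (a + m + 1)).hom v)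
    (by rw [map_sub, hz, tensor_d_d, sub_zero]) fun i j h hj => by
      obtain hi | rfl : i < a ∨ i = a := by omega
      · have := h0 i hi
        have : Subsingleton (K.X i ⊗ L.X j : ModuleCat R) :=
          inferInstanceAs (Subsingleton (TensorProduct R (K.X i) (L.X j)))
        exact Subsingleton.elim _ _
      · obtain rfl : j = m + 1 := by omega
        rw [hv', map_sub, map_add, map_add, tensorπ_d_ι_left, tensorπ_d_ι_right, hyw, map_zsmul,
          smul_smul, ← mul_pow]
        simp
  exact ⟨w' + v, by rw [map_add, hw', sub_add_cancel]⟩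

end columns

/-! ### Acyclicity of `R/I ⊗ Y` and `I ⊗ Y` -/

section independent

variable {C : ChainComplex (ModuleCat.{u} R) ℕ} {M : Type u} [AddCommGroup M] [Module R M]
  {ε : C.X 0 →ₗ[R] M}

lemma IsFreeResolution.exact_whiskerRight (hC : IsFreeResolution C ε) (N : ModuleCat.{u} R)
    [Module.Flat R N] (i : ℕ) :
    Function.Exact (C.d (i + 2) (i + 1) ▷ N).hom (C.d (i + 1) i ▷ N).hom :=
  Module.Flat.rTensor_exact N (hC.exact_succ i)

lemma IsFreeResolution.exact_whiskerLeft (hC : IsFreeResolution C ε) (N : ModuleCat.{u} R)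
    [Module.Flat R N] (i : ℕ) :
    Function.Exact (N ◁ C.d (i + 2) (i + 1)).hom (N ◁ C.d (i + 1) i).hom :=
  Module.Flat.lTensor_exact N (hC.exact_succ i)

variable {I J : Ideal R} {X Y : ChainComplex (ModuleCat.{u} R) ℕ}
  {εX : X.X 0 →ₗ[R] R ⧸ I} {εY : Y.X 0 →ₗ[R] R ⧸ J}

lemma whisker_comm_apply {A A' B B' : ModuleCat.{u} R} (f : A ⟶ A') (g : B ⟶ B')
    (x : (A ⊗ B : ModuleCat R)) :
    (A' ◁ g).hom ((f ▷ B).hom x) = (f ▷ B').hom ((A ◁ g).hom x) :=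
  congrArg (fun k => k.hom x) (whisker_exchange f g).symm

/-- The complex of the cokernels of `X₁ ⊗ Yⱼ ⟶ X₀ ⊗ Yⱼ` is `R ⧸ I ⊗ Y`. -/
lemma TorIndependent.exists_eq_zero (h : TorIndependent I J) (hX : IsFreeResolution X εX)
    (hY : IsFreeResolution Y εY) (m : ℕ) (x : (X.X 0 ⊗ Y.X (m + 1) : ModuleCat R))
    (hx : ∃ u, (X.d 1 0 ▷ Y.X m).hom u = (X.X 0 ◁ Y.d (m + 1) m).hom x) :
    ∃ y w, x = (X.X 0 ◁ Y.d (m + 2) (m + 1)).hom y + (X.d 1 0 ▷ Y.X (m + 1)).hom w := by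
  obtain ⟨u, hu⟩ := hx
  have comm : ∀ {A B : ModuleCat.{u} R} (g : A ⟶ B) (t : (X.X 0 ⊗ A : ModuleCat R)),
      εX.rTensor B ((X.X 0 ◁ g).hom t) = g.hom.lTensor (R ⧸ I) (εX.rTensor A t) := fun g t =>
    whisker_comm_apply (ModuleCat.ofHom εX) g t |>.symm
  have ex : ∀ j, Function.Exact (X.d 1 0 ▷ Y.X j).hom (εX.rTensor (Y.X j)) := fun j =>
    rTensor_exact (Y.X j) hX.exact_zero hX.surjective
  -- The hypothesis on `x` says that its class in `R/I ⊗ Yₘ₊₁` is a cycle; it is therefore the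
  -- boundary of some `t`, which lifts to `X₀ ⊗ Yₘ₊₂`.
  have h0 : (Y.d (m + 1) m).hom.lTensor (R ⧸ I) (εX.rTensor (Y.X (m + 1)) x) = 0 := by
    rw [← comm, ← hu]
    exact (ex m).apply_apply_eq_zero u
  obtain ⟨t, ht⟩ := (h.exact_lTensor hY m _).1 h0
  obtain ⟨y, rfl⟩ := LinearMap.rTensor_surjective (Y.X (m + 2)) hX.surjective t
  rw [← comm] at ht
  obtain ⟨w, hw⟩ := (ex (m + 1) (x - (X.X 0 ◁ Y.d (m + 2) (m + 1)).hom y)).1 (by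
    rw [map_sub, ht, sub_self])
  exact ⟨y, w, by rw [hw, add_sub_cancel]⟩

/-- The complex of the cokernels of `X₂ ⊗ Yⱼ ⟶ X₁ ⊗ Yⱼ` is `I ⊗ Y`. -/
lemma TorIndependent.exists_eq_one (h : TorIndependent I J) (hX : IsFreeResolution X εX)
    (hY : IsFreeResolution Y εY) (m : ℕ) (x : (X.X 1 ⊗ Y.X (m + 1) : ModuleCat R))
    (hx : ∃ u, (X.d 2 1 ▷ Y.X m).hom u = (X.X 1 ◁ Y.d (m + 1) m).hom x) :
    ∃ y w, x = (X.X 1 ◁ Y.d (m + 2) (m + 1)).hom y + (X.d 2 1 ▷ Y.X (m + 1)).hom w := by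
  obtain ⟨u, hu⟩ := hx
  have := hX.free 0
  have := hY.free
  -- Dimension shift: the image of `x` in `X₀ ⊗ Yₘ₊₁` is a cycle, hence the boundary of some `y'`,
  -- whose class in `R/I ⊗ Yₘ₊₂` is again a cycle. Tor-independence one degree higher splits `y'`,
  -- and its part `w` corrects `x`.
  obtain ⟨y', hy'⟩ := (hY.exact_whiskerLeft (X.X 0) m ((X.d 1 0 ▷ Y.X (m + 1)).hom x)).1 (by
    rw [whisker_comm_apply, ← hu]
    exact (hX.exact_whiskerRight (Y.X m) 0).apply_apply_eq_zero u)
  obtain ⟨y, w, rfl⟩ := h.exists_eq_zero hX hY (m + 1) y' ⟨x, hy'.symm⟩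
  obtain ⟨v, hv⟩ := (hX.exact_whiskerRight (Y.X (m + 1)) 0
    (x - (X.X 1 ◁ Y.d (m + 2) (m + 1)).hom w)).1 (by
      rw [map_sub, ← hy', map_add,
        (hY.exact_whiskerLeft (X.X 0) (m + 1)).apply_apply_eq_zero, zero_add,
        whisker_comm_apply, sub_self])
  exact ⟨w, v, by rw [hv, add_sub_cancel]⟩

end independent

/-! ### Acyclicity of the truncated tensor products and of the star product -/

section exactness

open HomologicalComplex hiding tensorObj

lemma free_trunc {C : ChainComplex (ModuleCat.{u} R) ℕ} (hC : ∀ n, Module.Free R (C.X n)) :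
    ∀ n, Module.Free R ((trunc C).X n)
  | 0 => inferInstanceAs (Module.Free R PUnit.{u + 1})
  | n + 1 => hC (n + 1)

instance subsingleton_trunc_X_zero (C : ChainComplex (ModuleCat.{u} R) ℕ) :
    Subsingleton ((trunc C).X 0) :=
  inferInstanceAs (Subsingleton PUnit)

instance subsingleton_trunc_X_zero_tensor (C : ChainComplex (ModuleCat.{u} R) ℕ)
    (N : ModuleCat.{u} R) : Subsingleton ((trunc C).X 0 ⊗ N : ModuleCat R) :=
  inferInstanceAs (Subsingleton (TensorProduct R ((trunc C).X 0) N))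

instance subsingleton_tensor_trunc_X_zero (C : ChainComplex (ModuleCat.{u} R) ℕ)
    (N : ModuleCat.{u} R) : Subsingleton (N ⊗ (trunc C).X 0 : ModuleCat R) :=
  inferInstanceAs (Subsingleton (TensorProduct R N ((trunc C).X 0)))

variable {I J : Ideal R} {X Y : ChainComplex (ModuleCat.{u} R) ℕ}
  {εX : X.X 0 →ₗ[R] R ⧸ I} {εY : Y.X 0 →ₗ[R] R ⧸ J}

lemma IsFreeResolution.exact_trunc_whiskerRight (hX : IsFreeResolution X εX) (N : ModuleCat.{u} R)
    [Module.Flat R N] (i : ℕ) (hi : 1 ≤ i) :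
    Function.Exact ((trunc X).d (i + 2) (i + 1) ▷ N).hom ((trunc X).d (i + 1) i ▷ N).hom := by
  obtain ⟨i, rfl⟩ := Nat.exists_eq_add_of_le' hi
  exact hX.exact_whiskerRight N (i + 1)

/-- `X_{≥ 1} ⊗ Y` is exact in degrees `≥ 2`. -/
lemma TorIndependent.exact_trunc_tensor (h : TorIndependent I J) (hX : IsFreeResolution X εX)
    (hY : IsFreeResolution Y εY) (n : ℕ) :
    Function.Exact ((HomologicalComplex.tensorObj (trunc X) Y).d (n + 3) (n + 2)).hom
      ((HomologicalComplex.tensorObj (trunc X) Y).d (n + 2) (n + 1)).hom := by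
  have := hY.free
  refine tensor_exact_of_columns (a := 1) (m := n) (by omega) (fun i hi => ?_)
    (fun i j hi => hX.exact_trunc_whiskerRight (Y.X j) i hi)
    (fun x hx => h.exists_eq_one hX hY n x hx)
  obtain rfl : i = 0 := by omega
  infer_instance

/-- `X ⊗ Y_{≥ 1}` is exact in degrees `≥ 2`. -/
lemma TorIndependent.exact_tensor_trunc (h : TorIndependent I J) (hX : IsFreeResolution X εX)
    (hY : IsFreeResolution Y εY) (n : ℕ) :
    Function.Exact ((HomologicalComplex.tensorObj X (trunc Y)).d (n + 3) (n + 2)).hom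
      ((HomologicalComplex.tensorObj X (trunc Y)).d (n + 2) (n + 1)).hom := by
  have := free_trunc hY.free
  exact tensor_exact_of_columns (a := 0) (m := n + 1) (by omega)
    (fun i hi => absurd hi (Nat.not_lt_zero i))
    (fun i j _ => hX.exact_whiskerRight ((trunc Y).X j) i)
    (fun x hx => h.exists_eq_zero hX hY (n + 1) x hx)

/-- `X_{≥ 1} ⊗ Y_{≥ 1}` is exact in degrees `≥ 3`. -/
lemma TorIndependent.exact_truncTensor (h : TorIndependent I J) (hX : IsFreeResolution X εX)
    (hY : IsFreeResolution Y εY) (n : ℕ) :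
    Function.Exact ((truncTensor X Y).d (n + 4) (n + 3)).hom
      ((truncTensor X Y).d (n + 3) (n + 2)).hom := by
  have := free_trunc hY.free
  refine tensor_exact_of_columns (a := 1) (m := n + 1) (by omega) (fun i hi => ?_)
    (fun i j hi => hX.exact_trunc_whiskerRight ((trunc Y).X j) i hi)
    (fun x hx => h.exists_eq_one hX hY (n + 1) x hx)
  obtain rfl : i = 0 := by omega
  infer_instance

/-- Every other summand in total degree 2 has a factor of index `0`, which the truncation kills. -/
lemma truncTensor_X_two_eq (z : (truncTensor X Y).X 2) :
    z = (ιTensorObj (trunc X) (trunc Y) 1 1 2 rfl).hom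
      ((tensorπ (trunc X) (trunc Y) 1 1 2 rfl).hom z) := by
  rw [← sub_eq_zero]
  refine tensor_eq_zero _ fun i j h => ?_
  obtain _ | i := i
  · exact Subsingleton.elim (α := ((trunc X).X 0 ⊗ (trunc Y).X j : ModuleCat R)) _ _
  obtain _ | j := j
  · exact Subsingleton.elim (α := ((trunc X).X (i + 1) ⊗ (trunc Y).X 0 : ModuleCat R)) _ _
  obtain rfl : i = 0 := by omega
  obtain rfl : j = 0 := by omega
  rw [map_sub, tensorπ_ι_self, sub_self]

lemma starAug_apply (z : (truncTensor X Y).X 2) :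
    (starAug X Y).hom z =
      (X.d 1 0 ⊗ₘ Y.d 1 0).hom ((tensorπ (trunc X) (trunc Y) 1 1 2 rfl).hom z) := by
  conv_lhs => rw [truncTensor_X_two_eq z]
  exact congrArg (fun f => f.hom ((tensorπ (trunc X) (trunc Y) 1 1 2 rfl).hom z))
    (ι_starAug X Y 1 1 rfl)

/-- The star product `X * Y` is exact in positive degrees. -/
lemma TorIndependent.exact_starProduct (h : TorIndependent I J) (hX : IsFreeResolution X εX)
    (hY : IsFreeResolution Y εY) :
    ∀ n, Function.Exact ((starProduct X Y).d (n + 2) (n + 1)).hom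
      ((starProduct X Y).d (n + 1) n).hom
  | n + 1 => h.exact_truncTensor hX hY n
  | 0 => by
    intro z
    refine ⟨fun hz => ?_, ?_⟩
    swap
    · rintro ⟨w, rfl⟩
      exact congrArg (fun f => f.hom w) ((starProduct X Y).d_comp_d 2 1 0)
    change (truncTensor X Y).X 2 at z
    change ∃ w, ((truncTensor X Y).d 3 2).hom w = z
    replace hz : (X.d 1 0 ⊗ₘ Y.d 1 0).hom ((tensorπ (trunc X) (trunc Y) 1 1 2 rfl).hom z) = 0 :=
      (starAug_apply z).symm.trans hz
    -- Factor `∂₁ ⊗ ∂₁` through `X₁ ⊗ Y₀`. Exactness of `X ⊗ Y₀` puts the image of the component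
    -- there in the range of `∂₂ ⊗ 1`, so the component is a 1-cycle of `I ⊗ Y`.
    rw [MonoidalCategory.tensorHom_def'] at hz
    have := hY.free 0
    obtain ⟨y, w, hyw⟩ : ∃ (y : ((trunc X).X 1 ⊗ (trunc Y).X 2 : ModuleCat R))
        (w : ((trunc X).X 2 ⊗ (trunc Y).X 1 : ModuleCat R)),
        (tensorπ (trunc X) (trunc Y) 1 1 2 rfl).hom z =
          ((trunc X).X 1 ◁ (trunc Y).d 2 1).hom y + ((trunc X).d 2 1 ▷ (trunc Y).X 1).hom w :=
      h.exists_eq_one hX hY 0 _ ((hX.exact_whiskerRight (Y.X 0) 0 _).1 hz)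
    -- The sign on `y` compensates `(-1) ^ |a|` with `|a| = 1`.
    refine ⟨(ιTensorObj (trunc X) (trunc Y) 1 2 3 rfl).hom (-y) +
      (ιTensorObj (trunc X) (trunc Y) 2 1 3 rfl).hom w, ?_⟩
    rw [truncTensor_X_two_eq z, truncTensor_X_two_eq (((truncTensor X Y).d 3 2).hom _)]
    congr 1
    rw [map_add, map_add, tensorπ_d_ι_right, tensorπ_d_ι_left, hyw]
    simp

lemma trunc_tensor_X_one_eq (z : (HomologicalComplex.tensorObj (trunc X) Y).X 1) :
    z = (ιTensorObj (trunc X) Y 1 0 1 rfl).hom ((tensorπ (trunc X) Y 1 0 1 rfl).hom z) := by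
  rw [← sub_eq_zero]
  refine tensor_eq_zero _ fun i j h => ?_
  obtain _ | i := i
  · exact Subsingleton.elim (α := ((trunc X).X 0 ⊗ Y.X j : ModuleCat R)) _ _
  obtain rfl : i = 0 := by omega
  obtain rfl : j = 0 := by omega
  rw [map_sub, tensorπ_ι_self, sub_self]

lemma tensor_trunc_X_one_eq (z : (HomologicalComplex.tensorObj X (trunc Y)).X 1) :
    z = (ιTensorObj X (trunc Y) 0 1 1 rfl).hom ((tensorπ X (trunc Y) 0 1 1 rfl).hom z) := by
  rw [← sub_eq_zero]
  refine tensor_eq_zero _ fun i j h => ?_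
  obtain _ | j := j
  · exact Subsingleton.elim (α := (X.X i ⊗ (trunc Y).X 0 : ModuleCat R)) _ _
  obtain rfl : i = 0 := by omega
  obtain rfl : j = 0 := by omega
  rw [map_sub, tensorπ_ι_self, sub_self]

end exactness

/-! ### Mapping cones elementwise -/

section cone

variable {A B : ChainComplex (ModuleCat.{u} R) ℕ} (f : A ⟶ B)

open HomologicalComplex

/-- The projection `Cone(f)ₙ₊₁ = Bₙ₊₁ ⊕ Aₙ ⟶ Aₙ`. -/
def coneFst (n : ℕ) : (cone f).X (n + 1) ⟶ A.X n :=
  homotopyCofiber.fstX f (n + 1) n rfl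

/-- The projection `Cone(f)ₙ ⟶ Bₙ`. -/
def coneSnd (n : ℕ) : (cone f).X n ⟶ B.X n :=
  homotopyCofiber.sndX f n

/-- The element `(b, a)` of `Cone(f)ₙ₊₁ = Bₙ₊₁ ⊕ Aₙ`. -/
def coneMk {n : ℕ} (b : B.X (n + 1)) (a : A.X n) : (cone f).X (n + 1) :=
  (show A.X n ⟶ (cone f).X (n + 1) from homotopyCofiber.inlX f n (n + 1) rfl).hom a +
    (show B.X (n + 1) ⟶ (cone f).X (n + 1) from homotopyCofiber.inrX f (n + 1)).hom b

lemma coneMk_fst_snd {n : ℕ} (z : (cone f).X (n + 1)) :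
    coneMk f ((coneSnd f (n + 1)).hom z) ((coneFst f n).hom z) = z := by
  have hr : (ComplexShape.down ℕ).Rel (n + 1) n := rfl
  have : homotopyCofiber.fstX f (n + 1) n hr ≫ homotopyCofiber.inlX f n (n + 1) hr +
      homotopyCofiber.sndX f (n + 1) ≫ homotopyCofiber.inrX f (n + 1) = 𝟙 _ :=
    homotopyCofiber.ext_to_X f (n + 1) n hr (by simp) (by simp)
  exact congrArg (fun k => k.hom z) this

@[simp]
lemma coneFst_mk {n : ℕ} (b : B.X (n + 1)) (a : A.X n) :
    (coneFst f n).hom (coneMk f b a) = a := by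
  have h1 := congrArg (fun k => k.hom a) (homotopyCofiber.inlX_fstX f n (n + 1) rfl)
  have h2 := congrArg (fun k => k.hom b) (homotopyCofiber.inrX_fstX f (n + 1) n rfl)
  exact (map_add _ _ _).trans ((congrArg₂ (· + ·) h1 h2).trans (add_zero a))

@[simp]
lemma coneSnd_mk {n : ℕ} (b : B.X (n + 1)) (a : A.X n) :
    (coneSnd f (n + 1)).hom (coneMk f b a) = b := by
  have h1 := congrArg (fun k => k.hom a) (homotopyCofiber.inlX_sndX f n (n + 1) rfl)
  have h2 := congrArg (fun k => k.hom b) (homotopyCofiber.inrX_sndX f (n + 1))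
  exact (map_add _ _ _).trans ((congrArg₂ (· + ·) h1 h2).trans (zero_add b))

lemma cone_ext {n : ℕ} {z w : (cone f).X (n + 1)}
    (h1 : (coneFst f n).hom z = (coneFst f n).hom w)
    (h2 : (coneSnd f (n + 1)).hom z = (coneSnd f (n + 1)).hom w) : z = w := by
  rw [← coneMk_fst_snd f z, h1, h2, coneMk_fst_snd]

lemma coneFst_d {n : ℕ} (z : (cone f).X (n + 2)) :
    (coneFst f n).hom (((cone f).d (n + 2) (n + 1)).hom z) =
      -(A.d (n + 1) n).hom ((coneFst f (n + 1)).hom z) :=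
  congrArg (fun k => k.hom z) (homotopyCofiber.d_fstX f (n + 2) (n + 1) n rfl rfl)

lemma coneSnd_d {n : ℕ} (z : (cone f).X (n + 1)) :
    (coneSnd f n).hom (((cone f).d (n + 1) n).hom z) =
      (f.f n).hom ((coneFst f n).hom z) + (B.d (n + 1) n).hom ((coneSnd f (n + 1)).hom z) :=
  congrArg (fun k => k.hom z) (homotopyCofiber.d_sndX f (n + 1) n rfl)

/-- `Cone(f)₀ = B₀`. -/
def coneXZeroEquiv : (cone f).X 0 ≃ₗ[R] B.X 0 :=
  Iso.toLinearEquiv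
    { hom := coneSnd f 0
      inv := homotopyCofiber.inrX f 0
      hom_inv_id := homotopyCofiber.sndX_inrX f 0 (by simp)
      inv_hom_id := homotopyCofiber.inrX_sndX f 0 }

/-- `Cone(f)ₙ₊₁ = Bₙ₊₁ ⊕ Aₙ`. -/
def coneXSuccEquiv (n : ℕ) : (cone f).X (n + 1) ≃ₗ[R] (B.X (n + 1) × A.X n) where
  toFun z := ((coneSnd f (n + 1)).hom z,
    (coneFst f n).hom z)
  map_add' _ _ := Prod.ext (map_add _ _ _) (map_add _ _ _)
  map_smul' _ _ := Prod.ext (map_smul _ _ _) (map_smul _ _ _)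
  invFun p := coneMk f p.1 p.2
  left_inv _ := cone_ext f (coneFst_mk f _ _) (coneSnd_mk f _ _)
  right_inv _ := Prod.ext (coneSnd_mk f _ _) (coneFst_mk f _ _)

lemma free_cone (hA : ∀ n, Module.Free R (A.X n)) (hB : ∀ n, Module.Free R (B.X n)) :
    ∀ n, Module.Free R ((cone f).X n)
  | 0 => have := hB 0; Module.Free.of_equiv (coneXZeroEquiv f).symm
  | n + 1 => have := hA n; have := hB (n + 1); Module.Free.of_equiv (coneXSuccEquiv f n).symm

/-- This is the piece `Hₙ₊₁(B) → Hₙ₊₁(Cone f) → Hₙ(A) → Hₙ(B)` of the long exact sequence: the first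
term vanishes and the last map is injective. Quantifying over all `m` expresses the cycle condition
uniformly, including `n = 0`, where it is empty. -/
lemma cone_exact {n : ℕ} (hB : Function.Exact (B.d (n + 2) (n + 1)).hom (B.d (n + 1) n).hom)
    (hA : ∀ a : A.X n, (∀ m, (A.d n m).hom a = 0) →
      (∃ b, (B.d (n + 1) n).hom b = (f.f n).hom a) → ∃ a', (A.d (n + 1) n).hom a' = a) :
    Function.Exact ((cone f).d (n + 2) (n + 1)).hom ((cone f).d (n + 1) n).hom := by
  intro z
  refine ⟨fun hz => ?_, ?_⟩
  swap
  · rintro ⟨w, rfl⟩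
    exact congrArg (fun k => k.hom w) ((cone f).d_comp_d (n + 2) (n + 1) n)
  have h1 := coneSnd_d f z
  rw [hz, map_zero] at h1
  obtain ⟨a', ha'⟩ := hA ((coneFst f n).hom z) (fun m => by
      by_cases hm : m + 1 = n
      · subst hm
        have := coneFst_d f z
        rw [hz, map_zero] at this
        exact neg_eq_zero.1 this.symm
      · rw [A.shape _ _ hm]; rfl)
    ⟨-(coneSnd f (n + 1)).hom z, by
      rw [map_neg]; exact (eq_neg_of_add_eq_zero_left h1.symm).symm⟩
  have hf : (f.f n).hom ((A.d (n + 1) n).hom a') = (B.d (n + 1) n).hom ((f.f (n + 1)).hom a') :=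
    congrArg (fun k => k.hom a') (f.comm (n + 1) n).symm
  -- Once the `A`-component is written as `∂a'`, adding `f a'` to the `B`-component makes it a cycle
  -- of `B`.
  obtain ⟨b, hb⟩ := (hB ((coneSnd f (n + 1)).hom z + (f.f (n + 1)).hom a')).1 (by
    rw [map_add, ← hf, ha', add_comm]
    exact h1.symm)
  refine ⟨coneMk f b (-a'), cone_ext f ?_ ?_⟩
  · rw [coneFst_d, coneFst_mk, map_neg, neg_neg, ha']
  · rw [coneSnd_d, coneFst_mk, coneSnd_mk, map_neg, hb]
    abel

end cone

/-! ### Injectivity of `Φ` and `Ψ` on `H₀` -/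

section exactness

open HomologicalComplex hiding tensorObj

variable {S T X Y : ChainComplex (ModuleCat.{u} R) ℕ}

lemma ι_liftLeft_f_zero (φ : S ⟶ X) :
    (show (S.X 1 ⊗ Y.X 0) ⟶ (HomologicalComplex.tensorObj (trunc S) Y).X 1 from
      ιTensorObj (trunc S) Y 1 0 1 rfl) ≫
      (liftLeft φ Y).f 0 = (S.d 1 0 ≫ φ.f 0) ▷ Y.X 0 :=
  ι_mapBifunctorDesc _ _ _ _

lemma ι_liftRight_f_zero (ψ : T ⟶ Y) :
    (show (X.X 0 ⊗ T.X 1) ⟶ (HomologicalComplex.tensorObj X (trunc T)).X 1 from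
      ιTensorObj X (trunc T) 0 1 1 rfl) ≫
      (liftRight X ψ).f 0 = X.X 0 ◁ (T.d 1 0 ≫ ψ.f 0) :=
  ι_mapBifunctorDesc _ _ _ _

lemma liftLeft_f_zero_apply (φ : S ⟶ X) (a : (HomologicalComplex.tensorObj (trunc S) Y).X 1) :
    ((liftLeft φ Y).f 0).hom a =
      ((S.d 1 0 ≫ φ.f 0) ▷ Y.X 0).hom ((tensorπ (trunc S) Y 1 0 1 rfl).hom a) := by
  conv_lhs => rw [trunc_tensor_X_one_eq a]
  exact congrArg (fun f => f.hom ((tensorπ (trunc S) Y 1 0 1 rfl).hom a))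
    (ι_liftLeft_f_zero φ)

lemma liftRight_f_zero_apply (ψ : T ⟶ Y) (a : (HomologicalComplex.tensorObj X (trunc T)).X 1) :
    ((liftRight X ψ).f 0).hom a =
      (X.X 0 ◁ (T.d 1 0 ≫ ψ.f 0)).hom ((tensorπ X (trunc T) 0 1 1 rfl).hom a) := by
  conv_lhs => rw [tensor_trunc_X_one_eq a]
  exact congrArg (fun f => f.hom ((tensorπ X (trunc T) 0 1 1 rfl).hom a))
    (ι_liftRight_f_zero ψ)

lemma desusp_exists_d_eq {C : ChainComplex (ModuleCat.{u} R) ℕ} {n : ℕ}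
    (hC : Function.Exact (C.d (n + 3) (n + 2)).hom (C.d (n + 2) (n + 1)).hom)
    (a : (desusp C).X (n + 1)) (ha : ∀ m, ((desusp C).d (n + 1) m).hom a = 0) :
    ∃ a', ((desusp C).d (n + 2) (n + 1)).hom a' = a := by
  obtain ⟨a', ha'⟩ := (hC a).1 (neg_eq_zero.1 (ha n))
  refine ⟨-a', ?_⟩
  refine (map_neg (-(C.d (n + 3) (n + 2)).hom) a').trans ?_
  simpa using ha'

variable {I J : Ideal R} {εX : X.X 0 →ₗ[R] R ⧸ I} {εY : Y.X 0 →ₗ[R] R ⧸ J}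

/-- Injectivity of `I' ⊗ R/J → R/IJ`. The chase uses `φ` only through the isomorphism `φ₀`, which
carries elements over `X₀` back to `S₀`. -/
lemma TorIndependent.exists_d_eq_of_liftLeft {I' : Ideal R} {εS : S.X 0 →ₗ[R] R ⧸ I'}
    (h : TorIndependent I' J) (hS : IsFreeResolution S εS) (hY : IsFreeResolution Y εY)
    (φ : S ⟶ X) [IsIso (φ.f 0)] (a : (HomologicalComplex.tensorObj (trunc S) Y).X 1)
    (ha : ∃ b, ((starProduct X Y).d 1 0).hom b = ((liftLeft φ Y).f 0).hom a) :
    ∃ a', ((HomologicalComplex.tensorObj (trunc S) Y).d 2 1).hom a' = a := by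
  obtain ⟨b, hb⟩ := ha
  obtain ⟨t, ht⟩ : ∃ t : (S.X 1 ⊗ Y.X 0 : ModuleCat R),
    t = (tensorπ (trunc S) Y 1 0 1 rfl).hom a := ⟨_, rfl⟩
  obtain ⟨c, hc⟩ : ∃ c : (X.X 1 ⊗ Y.X 1 : ModuleCat R),
    c = (tensorπ (trunc X) (trunc Y) 1 1 2 rfl).hom b := ⟨_, rfl⟩
  replace hb : (X.d 1 0 ⊗ₘ Y.d 1 0).hom c = ((S.d 1 0 ≫ φ.f 0) ▷ Y.X 0).hom t := by
    rw [hc, ht]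
    exact (starAug_apply b).symm.trans (hb.trans (liftLeft_f_zero_apply φ a))
  set x := (inv (φ.f 0) ▷ Y.X 1).hom ((X.d 1 0 ▷ Y.X 1).hom c) with hx
  have hxt : (S.d 1 0 ▷ Y.X 0).hom t = (S.X 0 ◁ Y.d 1 0).hom x := by
    have := congrArg (inv (φ.f 0) ▷ Y.X 0).hom hb
    rw [hx, whisker_comm_apply]
    simp only [MonoidalCategory.tensorHom_def, ← LinearMap.comp_apply,
      ← ModuleCat.hom_comp, Category.assoc, ← MonoidalCategory.comp_whiskerRight,
      IsIso.hom_inv_id, Category.comp_id] at this ⊢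
    exact this.symm
  -- Here `x` is a 1-cycle of `R/I' ⊗ Y`, so `Tor₁(R/I', R/J) = 0` applies. Its part `w` in `S₁ ⊗
  -- Y₁` makes `t - ∂w` a cycle of the column `S ⊗ Y₀`.
  obtain ⟨y, w, hyw⟩ := h.exists_eq_zero hS hY 0 x ⟨t, hxt⟩
  have := hY.free 0
  obtain ⟨v, hv⟩ := (hS.exact_whiskerRight (Y.X 0) 0 (t - (S.X 1 ◁ Y.d 1 0).hom w)).1 (by
    have := hY.free 1
    have := hS.free 0
    rw [map_sub, hxt, hyw, map_add, (hY.exact_whiskerLeft (S.X 0) 0).apply_apply_eq_zero,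
      zero_add, whisker_comm_apply, sub_self])
  -- The same data, retyped over the truncation so that the coordinate lemmas apply.
  obtain ⟨v, w, hvw⟩ : ∃ (v : ((trunc S).X 2 ⊗ Y.X 0 : ModuleCat R))
      (w : ((trunc S).X 1 ⊗ Y.X 1 : ModuleCat R)), (tensorπ (trunc S) Y 1 0 1 rfl).hom a =
        ((trunc S).d 2 1 ▷ Y.X 0).hom v + ((trunc S).X 1 ◁ Y.d 1 0).hom w :=
    ⟨v, w, ht.symm.trans (eq_add_of_sub_eq hv.symm)⟩
  refine ⟨(ιTensorObj (trunc S) Y 2 0 2 rfl).hom v +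
    (ιTensorObj (trunc S) Y 1 1 2 rfl).hom (-w), ?_⟩
  rw [trunc_tensor_X_one_eq a, trunc_tensor_X_one_eq (((HomologicalComplex.tensorObj (trunc S) Y).d 2 1).hom _)]
  congr 1
  rw [map_add, map_add, tensorπ_d_ι_right, tensorπ_d_ι_left, hvw]
  simp

/-- Injectivity of `R/I ⊗ J' → R/IJ`. This is shorter than the left-hand case: after applying
`ψ₀⁻¹`, the hypothesis says directly that `t` is a 1-cycle of `R/I ⊗ T`. -/
lemma TorIndependent.exists_d_eq_of_liftRight {J' : Ideal R} {εT : T.X 0 →ₗ[R] R ⧸ J'}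
    (h : TorIndependent I J') (hX : IsFreeResolution X εX) (hT : IsFreeResolution T εT)
    (ψ : T ⟶ Y) [IsIso (ψ.f 0)] (a : (HomologicalComplex.tensorObj X (trunc T)).X 1)
    (ha : ∃ b, ((starProduct X Y).d 1 0).hom b = ((liftRight X ψ).f 0).hom a) :
    ∃ a', ((HomologicalComplex.tensorObj X (trunc T)).d 2 1).hom a' = a := by
  obtain ⟨b, hb⟩ := ha
  obtain ⟨t, ht⟩ : ∃ t : (X.X 0 ⊗ T.X 1 : ModuleCat R),
    t = (tensorπ X (trunc T) 0 1 1 rfl).hom a := ⟨_, rfl⟩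
  obtain ⟨c, hc⟩ : ∃ c : (X.X 1 ⊗ Y.X 1 : ModuleCat R),
    c = (tensorπ (trunc X) (trunc Y) 1 1 2 rfl).hom b := ⟨_, rfl⟩
  replace hb : (X.d 1 0 ⊗ₘ Y.d 1 0).hom c = (X.X 0 ◁ (T.d 1 0 ≫ ψ.f 0)).hom t := by
    rw [hc, ht]
    exact (starAug_apply b).symm.trans (hb.trans (liftRight_f_zero_apply ψ a))
  obtain ⟨y, w, hyw⟩ := h.exists_eq_zero hX hT 0 t
    ⟨(X.X 1 ◁ inv (ψ.f 0)).hom ((X.X 1 ◁ Y.d 1 0).hom c), by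
      have := congrArg (X.X 0 ◁ inv (ψ.f 0)).hom hb
      rw [← whisker_comm_apply]
      simp only [MonoidalCategory.tensorHom_def', ← LinearMap.comp_apply,
        ← ModuleCat.hom_comp, Category.assoc, ← MonoidalCategory.whiskerLeft_comp,
        IsIso.hom_inv_id, Category.comp_id] at this ⊢
      exact this⟩
  obtain ⟨y, w, hyw⟩ : ∃ (y : (X.X 0 ⊗ (trunc T).X 2 : ModuleCat R))
      (w : (X.X 1 ⊗ (trunc T).X 1 : ModuleCat R)), (tensorπ X (trunc T) 0 1 1 rfl).hom a =
        (X.X 0 ◁ (trunc T).d 2 1).hom y + (X.d 1 0 ▷ (trunc T).X 1).hom w :=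
    ⟨y, w, ht.symm.trans hyw⟩
  refine ⟨(ιTensorObj X (trunc T) 0 2 2 rfl).hom y +
    (ιTensorObj X (trunc T) 1 1 2 rfl).hom w, ?_⟩
  rw [tensor_trunc_X_one_eq a,
    tensor_trunc_X_one_eq (((HomologicalComplex.tensorObj X (trunc T)).d 2 1).hom _)]
  congr 1
  rw [map_add, map_add, tensorπ_d_ι_right, tensorπ_d_ι_left, hyw]
  simp

lemma free_starProduct (hX : ∀ n, Module.Free R (X.X n)) (hY : ∀ n, Module.Free R (Y.X n)) :
    ∀ n, Module.Free R ((starProduct X Y).X n)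
  | 0 => have := hX 0; have := hY 0
    inferInstanceAs (Module.Free R (TensorProduct R (X.X 0) (Y.X 0)))
  | n + 1 => free_tensorObj (free_trunc hX) (free_trunc hY) (n + 2)

end exactness

/-! ### The image of `∂₁` in `R` -/

section augmentation

lemma range_lid_comp_map {A B : Type*} [AddCommGroup A] [AddCommGroup B] [Module R A] [Module R B]
    (f : A →ₗ[R] R) (g : B →ₗ[R] R) :
    LinearMap.range ((TensorProduct.lid R R).toLinearMap ∘ₗ TensorProduct.map f g) =
      (LinearMap.range f : Ideal R) * (LinearMap.range g : Ideal R) := by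
  apply le_antisymm
  · rintro _ ⟨t, rfl⟩
    induction t with
    | zero => simp
    | add x y hx hy => rw [map_add]; exact add_mem hx hy
    | tmul a b => exact Ideal.mul_mem_mul ⟨a, rfl⟩ ⟨b, rfl⟩
  · rw [Ideal.mul_le]
    rintro _ ⟨a, rfl⟩ _ ⟨b, rfl⟩
    exact ⟨a ⊗ₜ b, rfl⟩

lemma IsFreeResolution.range_d {C : ChainComplex (ModuleCat.{u} R) ℕ} {I : Ideal R}
    {e : C.X 0 ≃ₗ[R] R} (hC : IsFreeResolution C (Submodule.mkQ I ∘ₗ e.toLinearMap)) :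
    LinearMap.range (e.toLinearMap ∘ₗ (C.d 1 0).hom) = I := by
  ext r
  have := hC.exact_zero (e.symm r)
  simp only [LinearMap.comp_apply, LinearEquiv.coe_coe, LinearEquiv.apply_symm_apply,
    Submodule.mkQ_apply, Submodule.Quotient.mk_eq_zero] at this
  rw [this]
  simp [LinearEquiv.eq_symm_apply]

lemma exact_mkQ_of_range {A B : Type*} [AddCommGroup A] [AddCommGroup B] [Module R A] [Module R B]
    {d : A →ₗ[R] B} {e : B ≃ₗ[R] R} {I : Ideal R}
    (h : LinearMap.range (e.toLinearMap ∘ₗ d) = I) :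
    Function.Exact d (Submodule.mkQ I ∘ₗ e.toLinearMap) := by
  intro b
  simp only [LinearMap.comp_apply, LinearEquiv.coe_coe, Submodule.mkQ_apply,
    Submodule.Quotient.mk_eq_zero, ← h, LinearMap.mem_range, Set.mem_range,
    EmbeddingLike.apply_eq_iff_eq]

variable {A B : ChainComplex (ModuleCat.{u} R) ℕ}

/-- In degree 1 the cone differential is `(b, a) ↦ ∂b + f a`, so its image is a sum of two ideals:
for `Φ` these are `I'` and `IJ`. -/
lemma range_cone_d (f : A ⟶ B) (e : B.X 0 ≃ₗ[R] R) :
    LinearMap.range ((coneXZeroEquiv f ≪≫ₗ e).toLinearMap ∘ₗ ((cone f).d 1 0).hom) =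
      LinearMap.range (e.toLinearMap ∘ₗ (f.f 0).hom) ⊔
        LinearMap.range (e.toLinearMap ∘ₗ (B.d 1 0).hom) := by
  have key (z : (cone f).X 1) : (coneXZeroEquiv f ≪≫ₗ e) (((cone f).d 1 0).hom z) =
      e ((f.f 0).hom ((coneFst f 0).hom z)) + e ((B.d 1 0).hom ((coneSnd f 1).hom z)) :=
    (congrArg e (coneSnd_d f z)).trans (map_add _ _ _)
  apply le_antisymm
  · rintro _ ⟨z, rfl⟩
    exact (key z).symm ▸ Submodule.add_mem_sup ⟨_, rfl⟩ ⟨_, rfl⟩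
  · rw [sup_le_iff]
    constructor
    · rintro _ ⟨a, rfl⟩
      exact ⟨coneMk f 0 a, (key _).trans ((congrArg₂ (fun x y => e ((f.f 0).hom x) +
        e ((B.d 1 0).hom y)) (coneFst_mk f 0 a) (coneSnd_mk f 0 a)).trans (by simp))⟩
    · rintro _ ⟨b, rfl⟩
      exact ⟨coneMk f b 0, (key _).trans ((congrArg₂ (fun x y => e ((f.f 0).hom x) +
        e ((B.d 1 0).hom y)) (coneFst_mk f b 0) (coneSnd_mk f b 0)).trans (by simp))⟩

variable {X Y S T : ChainComplex (ModuleCat.{u} R) ℕ} (eX : X.X 0 ≃ₗ[R] R) (eY : Y.X 0 ≃ₗ[R] R)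

/-- `(X * Y)₀ = X₀ ⊗ Y₀` is free of rank one when `X₀` and `Y₀` are. -/
def starProductXZeroEquiv : (starProduct X Y).X 0 ≃ₗ[R] R :=
  (show (TensorProduct R (X.X 0) (Y.X 0)) ≃ₗ[R] R from
    TensorProduct.congr eX eY ≪≫ₗ TensorProduct.lid R R)

lemma tensorπ_surjective (K L : ChainComplex (ModuleCat.{u} R) ℕ) (i j n : ℕ) (h : i + j = n) :
    Function.Surjective (tensorπ K L i j n h).hom :=
  fun x => ⟨_, tensorπ_ι_self h x⟩

lemma range_comp_eq_of_surjective {A B C : ModuleCat.{u} R} (f : A ⟶ C) (p : A ⟶ B) (g : B ⟶ C)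
    (hp : Function.Surjective p.hom) (h : ∀ a, f.hom a = g.hom (p.hom a)) (e : C →ₗ[R] R) :
    LinearMap.range (e ∘ₗ f.hom) = LinearMap.range (e ∘ₗ g.hom) := by
  rw [show f.hom = g.hom ∘ₗ p.hom from LinearMap.ext h, ← LinearMap.comp_assoc,
    LinearMap.range_comp_of_range_eq_top]
  exact LinearMap.range_eq_top.2 hp

lemma range_starProduct_d {I J : Ideal R}
    (hX : IsFreeResolution X (Submodule.mkQ I ∘ₗ eX.toLinearMap))
    (hY : IsFreeResolution Y (Submodule.mkQ J ∘ₗ eY.toLinearMap)) :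
    LinearMap.range ((starProductXZeroEquiv eX eY).toLinearMap ∘ₗ
      ((starProduct X Y).d 1 0).hom) = I * J := by
  have h := range_lid_comp_map (eX.toLinearMap ∘ₗ (X.d 1 0).hom) (eY.toLinearMap ∘ₗ (Y.d 1 0).hom)
  rw [hX.range_d, hY.range_d, TensorProduct.map_comp] at h
  exact (range_comp_eq_of_surjective (C := X.X 0 ⊗ Y.X 0) (starAug X Y)
    (tensorπ (trunc X) (trunc Y) 1 1 2 rfl) (X.d 1 0 ⊗ₘ Y.d 1 0)
    (tensorπ_surjective (trunc X) (trunc Y) 1 1 2 rfl) starAug_apply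
    (starProductXZeroEquiv eX eY).toLinearMap).trans h

lemma range_liftLeft_f_zero {I' : Ideal R} {eS : S.X 0 ≃ₗ[R] R}
    (hS : IsFreeResolution S (Submodule.mkQ I' ∘ₗ eS.toLinearMap))
    (φ : S ⟶ X) (hφ : ∀ s : S.X 0, eX ((φ.f 0).hom s) = eS s) :
    LinearMap.range ((starProductXZeroEquiv eX eY).toLinearMap ∘ₗ ((liftLeft φ Y).f 0).hom) =
      I' := by
  have h := range_lid_comp_map (eX.toLinearMap ∘ₗ (S.d 1 0 ≫ φ.f 0).hom)
    (eY.toLinearMap ∘ₗ LinearMap.id)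
  have h' : eX.toLinearMap ∘ₗ (S.d 1 0 ≫ φ.f 0).hom = eS.toLinearMap ∘ₗ (S.d 1 0).hom :=
    LinearMap.ext fun s => hφ _
  have h'' : LinearMap.range (eX.toLinearMap ∘ₗ (S.d 1 0 ≫ φ.f 0).hom) = I' := by
    rw [h', hS.range_d]
  -- The factor `Y₀` contributes the unit ideal, so the product ideal is `I'` itself.
  rw [h'', LinearMap.comp_id, LinearEquiv.range, Ideal.mul_top,
    ← LinearMap.comp_id eY.toLinearMap, TensorProduct.map_comp] at h
  exact (range_comp_eq_of_surjective (C := X.X 0 ⊗ Y.X 0) ((liftLeft φ Y).f 0)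
    (tensorπ (trunc S) Y 1 0 1 rfl) ((S.d 1 0 ≫ φ.f 0) ▷ Y.X 0)
    (tensorπ_surjective (trunc S) Y 1 0 1 rfl) (liftLeft_f_zero_apply φ)
    (starProductXZeroEquiv eX eY).toLinearMap).trans h

lemma range_liftRight_f_zero {J' : Ideal R} {eT : T.X 0 ≃ₗ[R] R}
    (hT : IsFreeResolution T (Submodule.mkQ J' ∘ₗ eT.toLinearMap))
    (ψ : T ⟶ Y) (hψ : ∀ t : T.X 0, eY ((ψ.f 0).hom t) = eT t) :
    LinearMap.range ((starProductXZeroEquiv eX eY).toLinearMap ∘ₗ ((liftRight X ψ).f 0).hom) =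
      J' := by
  have h := range_lid_comp_map (eX.toLinearMap ∘ₗ LinearMap.id)
    (eY.toLinearMap ∘ₗ (T.d 1 0 ≫ ψ.f 0).hom)
  have h' : eY.toLinearMap ∘ₗ (T.d 1 0 ≫ ψ.f 0).hom = eT.toLinearMap ∘ₗ (T.d 1 0).hom :=
    LinearMap.ext fun s => hψ _
  have h'' : LinearMap.range (eY.toLinearMap ∘ₗ (T.d 1 0 ≫ ψ.f 0).hom) = J' := by
    rw [h', hT.range_d]
  rw [h'', LinearMap.comp_id, LinearEquiv.range, Ideal.top_mul,
    ← LinearMap.comp_id eX.toLinearMap, TensorProduct.map_comp] at h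
  exact (range_comp_eq_of_surjective (C := X.X 0 ⊗ Y.X 0) ((liftRight X ψ).f 0)
    (tensorπ X (trunc T) 0 1 1 rfl) (X.X 0 ◁ (T.d 1 0 ≫ ψ.f 0))
    (tensorπ_surjective X (trunc T) 0 1 1 rfl) (liftRight_f_zero_apply ψ)
    (starProductXZeroEquiv eX eY).toLinearMap).trans h

lemma isIso_of_linearEquiv_comm {M N : ModuleCat.{u} R} (f : M ⟶ N) (eM : M ≃ₗ[R] R)
    (eN : N ≃ₗ[R] R) (h : ∀ m, eN (f.hom m) = eM m) : IsIso f := by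
  have hf : f = (eM ≪≫ₗ eN.symm).toModuleIso.hom := by
    ext m
    exact eN.injective (by simpa using h m)
  rw [hf]
  infer_instance

end augmentation

/-! ### The cones are resolutions -/

section resolutions

variable {X Y S T : ChainComplex (ModuleCat.{u} R) ℕ} {eX : X.X 0 ≃ₗ[R] R} {eY : Y.X 0 ≃ₗ[R] R}
  {eS : S.X 0 ≃ₗ[R] R} {eT : T.X 0 ≃ₗ[R] R} {I J I' J' : Ideal R}

theorem isFreeResolution_cone_liftLeft (hIJ : TorIndependent I J) (hI'J : TorIndependent I' J)
    (hX : IsFreeResolution X (Submodule.mkQ I ∘ₗ eX.toLinearMap))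
    (hY : IsFreeResolution Y (Submodule.mkQ J ∘ₗ eY.toLinearMap))
    (hS : IsFreeResolution S (Submodule.mkQ I' ∘ₗ eS.toLinearMap))
    (φ : S ⟶ X) (hφ : ∀ s : S.X 0, eX ((φ.f 0).hom s) = eS s) :
    IsFreeResolution (cone (liftLeft φ Y)) (Submodule.mkQ (I' ⊔ I * J) ∘ₗ
      (coneXZeroEquiv (liftLeft φ Y) ≪≫ₗ starProductXZeroEquiv eX eY).toLinearMap) where
  free := free_cone _ (fun n => free_tensorObj (free_trunc hS.free) hY.free (n + 1))
    (free_starProduct hX.free hY.free)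
  exact_succ n := by
    have := isIso_of_linearEquiv_comm (φ.f 0) eS eX hφ
    refine cone_exact _ (hIJ.exact_starProduct hX hY n) fun a ha hb => ?_
    -- Degree 0 of the desuspension needs injectivity on `H₀`; above it the desuspension is acyclic.
    -- The witness `-a'` absorbs the sign of its differential.
    cases n with
    | zero =>
      obtain ⟨a', ha'⟩ := hI'J.exists_d_eq_of_liftLeft hS hY φ a hb
      exact ⟨-a', (map_neg (-((HomologicalComplex.tensorObj (trunc S) Y).d 2 1).hom) a').trans
        ((neg_neg _).trans ha')⟩
    | succ n => exact desusp_exists_d_eq (hI'J.exact_trunc_tensor hS hY n) a ha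
  exact_zero := exact_mkQ_of_range (by
    rw [range_cone_d, range_liftLeft_f_zero eX eY hS φ hφ, range_starProduct_d eX eY hX hY])
  surjective := (Submodule.mkQ_surjective _).comp (LinearEquiv.surjective _)

theorem isFreeResolution_cone_liftRight (hIJ : TorIndependent I J) (hIJ' : TorIndependent I J')
    (hX : IsFreeResolution X (Submodule.mkQ I ∘ₗ eX.toLinearMap))
    (hY : IsFreeResolution Y (Submodule.mkQ J ∘ₗ eY.toLinearMap))
    (hT : IsFreeResolution T (Submodule.mkQ J' ∘ₗ eT.toLinearMap))
    (ψ : T ⟶ Y) (hψ : ∀ t : T.X 0, eY ((ψ.f 0).hom t) = eT t) :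
    IsFreeResolution (cone (liftRight X ψ)) (Submodule.mkQ (I * J ⊔ J') ∘ₗ
      (coneXZeroEquiv (liftRight X ψ) ≪≫ₗ starProductXZeroEquiv eX eY).toLinearMap) where
  free := free_cone _ (fun n => free_tensorObj hX.free (free_trunc hT.free) (n + 1))
    (free_starProduct hX.free hY.free)
  exact_succ n := by
    have := isIso_of_linearEquiv_comm (ψ.f 0) eT eY hψ
    refine cone_exact _ (hIJ.exact_starProduct hX hY n) fun a ha hb => ?_
    cases n with
    | zero =>
      obtain ⟨a', ha'⟩ := hIJ'.exists_d_eq_of_liftRight hX hT ψ a hb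
      exact ⟨-a', (map_neg (-((HomologicalComplex.tensorObj X (trunc T)).d 2 1).hom) a').trans
        ((neg_neg _).trans ha')⟩
    | succ n => exact desusp_exists_d_eq (hIJ'.exact_tensor_trunc hX hT n) a ha
  exact_zero := exact_mkQ_of_range (by
    rw [range_cone_d, range_liftRight_f_zero eX eY hT ψ hψ, range_starProduct_d eX eY hX hY,
      sup_comm])
  surjective := (Submodule.mkQ_surjective _).comp (LinearEquiv.surjective _)

end resolutions

end

end StarCone

open CategoryTheory StarCone in
theorem theorem4p5 {R : Type u} [CommRing R] (I J I' J' : Ideal R) (hI : I' ≤ I) (hJ : J' ≤ J)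
    (hIJ : TorIndependent I J) (hI'J : TorIndependent I' J) (hIJ' : TorIndependent I J')
    (X Y S T : ChainComplex (ModuleCat.{u} R) ℕ)
    (eX : X.X 0 ≃ₗ[R] R) (eY : Y.X 0 ≃ₗ[R] R) (eS : S.X 0 ≃ₗ[R] R) (eT : T.X 0 ≃ₗ[R] R)
    (hX : IsFreeResolution X (Submodule.mkQ I ∘ₗ eX.toLinearMap))
    (hY : IsFreeResolution Y (Submodule.mkQ J ∘ₗ eY.toLinearMap))
    (hS : IsFreeResolution S (Submodule.mkQ I' ∘ₗ eS.toLinearMap))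
    (hT : IsFreeResolution T (Submodule.mkQ J' ∘ₗ eT.toLinearMap))
    (φ : S ⟶ X) (hφ : ∀ s : S.X 0, eX ((φ.f 0).hom s) = eS s)
    (ψ : T ⟶ Y) (hψ : ∀ t : T.X 0, eY ((ψ.f 0).hom t) = eT t) :
    (∃ e : (cone (liftLeft φ Y)).X 0 ≃ₗ[R] R,
      IsFreeResolution (cone (liftLeft φ Y))
        (Submodule.mkQ (I' ⊔ I * J) ∘ₗ e.toLinearMap)) ∧
    (∃ e : (cone (liftRight X ψ)).X 0 ≃ₗ[R] R,
      IsFreeResolution (cone (liftRight X ψ))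
        (Submodule.mkQ (I * J ⊔ J') ∘ₗ e.toLinearMap)) :=
  ⟨⟨_, isFreeResolution_cone_liftLeft hIJ hI'J hX hY hS φ hφ⟩,
    ⟨_, isFreeResolution_cone_liftRight hIJ hIJ' hX hY hT ψ hψ⟩⟩
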